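/- Let $0<n_3<n_1<n_2$ and set $\kappa_1=n_2/n_1$, $\kappa_2=n_3/n_2$, so that $\kappa_1>1$, $0<\kappa_2<1$, $\kappa_1\kappa_2<1$. Let $C<0$, let $\Omega,\Omega^*\subset\mathbb R^2$ be plane domains (open, connected, non-empty) with $\Omega$ simply connected, let $T:\Omega\to\Omega^*$ be bijective and of class $C^1$, put $Sx=Tx-x$, and let $x_0\in\Omega$. Write $D$ for the gradient, $\operatorname{curl}S=\partial_{x_1}S_2-\partial_{x_2}S_1$ and $a\times b=a_1b_2-a_2b_1$. The curl conditions are $$\operatorname{curl}S=0,\qquad S\times D(|S|^2)=0. \tag{1}$$ (a) Suppose that $|Sx_0|<\dfrac{-C\sqrt{\kappa_1^2-1}}{\kappa_1(\kappa_1-\kappa_2)}$ and that (1) holds at all points of a neighborhood of $x_0$. Then for every $\delta_0$ with $$0<\delta_0<\frac{1}{1-\kappa_1\kappa_2}\left(-C-\frac{\kappa_1(\kappa_1-\kappa_2)}{\sqrt{\kappa_1^2-1}}\,|Sx_0|\right)$$ there are an open neighborhood $U\subset\Omega$ of $x_0$ and a unique $u\in C^2(U)$ that solves the imaging PDE $$\frac{(1-\kappa_1\kappa_2)u(x)+C}{(\kappa_1^2-\kappa_1\kappa_2)\sqrt{\kappa_1^2+(\kappa_1^2-1)|Du(x)|^2}+\kappa_1^2(1-\kappa_1\kappa_2)}\,Du(x)=\frac{Sx}{\kappa_1^2-1}$$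 in $U$ and satisfies $u(x_0)=\delta_0$ and $0<u(x)<\dfrac{-C}{1-\kappa_1\kappa_2}$ for every $x\in U$. (b) Let $\bar Sx=\dfrac{\kappa_1(\kappa_1-\kappa_2)^2}{1-\kappa_1\kappa_2}\,Sx$ and, for $z\neq0$ and $|\bar Sx|<|z|$, let $$F(x,z)=\phi\!\left(\frac{|\bar Sx|^2}{z^2}\right)\frac{\bar Sx}{z},\qquad \phi(r)=\frac{\kappa_1(1-\kappa_1\kappa_2)r+\kappa_1\sqrt{(\kappa_1-\kappa_2)^2-(1-\kappa_2^2)(\kappa_1^2-1)r}}{1-r}+\kappa_1(1-\kappa_1\kappa_2),$$ which is the right-hand side of the imaging PDE written as $Dv=F(x,v)$ for $v=\left(u+\frac{C}{1-\kappa_1\kappa_2}\right)(\kappa_1-\kappa_2)\sqrt{\kappa_1^2-1}$. Then for every $z_0<0$ with $|\bar Sx_0|<|z_0|$, the integrability condition $$\frac{\partial F_1}{\partial x_2}+\frac{\partial F_1}{\partial z}F_2=\frac{\partial F_2}{\partial x_1}+\frac{\partial F_2}{\partial z}F_1$$ holds at all points $(x,z)$ of a neighborhood of $(x_0,z_0)$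 if and only if (1) holds at all points $x$ of a neighborhood of $x_0$. -/

import Mathlib

open Set Filter Topology

noncomputable section

namespace ImagingLens

/-- The Euclidean plane. -/
abbrev Plane : Type := EuclideanSpace ℝ (Fin 2)

/-- The displacement field `S x = T x - x` of a map `T`. -/
def displacement (T : Plane → Plane) (x : Plane) : Plane := T x - x

/-- The partial derivative `∂f/∂x_j` of a real function on the plane
(coordinates are numbered `0, 1`). -/
def partialDeriv (j : Fin 2) (f : Plane → ℝ) (x : Plane) : ℝ :=
  fderiv ℝ f x (EuclideanSpace.single j 1)

/-- The two-dimensional curl `∂S₂/∂x₁ - ∂S₁/∂x₂` (the components `S₁, S₂` have indices `0, 1`). -/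
def curl (S : Plane → Plane) (x : Plane) : ℝ :=
  partialDeriv 0 (fun y => S y 1) x - partialDeriv 1 (fun y => S y 0) x

/-- The two-dimensional cross product `a₁ b₂ - a₂ b₁`. -/
def cross (a b : Plane) : ℝ := a 0 * b 1 - a 1 * b 0

/-- Both curl conditions at `x`: `curl S = 0` and `S × D(|S|²) = 0`. -/
def CurlConditions (S : Plane → Plane) (x : Plane) : Prop :=
  curl S x = 0 ∧ cross (S x) (gradient (fun y => ‖S y‖ ^ 2) x) = 0

/-- The imaging PDE for the lower face `u` of the lens at the point `x`, where `Du` is the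
gradient of `u`:
`((1 - κ₁κ₂) u + C) / ((κ₁² - κ₁κ₂) √(κ₁² + (κ₁² - 1)|Du|²) + κ₁² (1 - κ₁κ₂)) · Du
  = S x / (κ₁² - 1)`. -/
def ImagingPDEAt (κ₁ κ₂ C : ℝ) (S : Plane → Plane) (u : Plane → ℝ) (x : Plane) : Prop :=
  (((1 - κ₁ * κ₂) * u x + C) /
      ((κ₁ ^ 2 - κ₁ * κ₂) * √(κ₁ ^ 2 + (κ₁ ^ 2 - 1) * ‖gradient u x‖ ^ 2)
        + κ₁ ^ 2 * (1 - κ₁ * κ₂))) • gradient u x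
    = (1 / (κ₁ ^ 2 - 1)) • S x

/-- `u` is of class `C²` on the set `U`, solves the imaging PDE in `U`, takes the value `δ₀`
at `x₀`, and satisfies `0 < u < -C / (1 - κ₁κ₂)` in `U`. -/
structure IsImagingSolution (κ₁ κ₂ C : ℝ) (S : Plane → Plane) (x₀ : Plane) (δ₀ : ℝ)
    (U : Set Plane) (u : Plane → ℝ) : Prop where
  contDiffOn : ContDiffOn ℝ 2 u U
  pde : ∀ x ∈ U, ImagingPDEAt κ₁ κ₂ C S u x
  initial : u x₀ = δ₀
  pos : ∀ x ∈ U, 0 < u x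
  lt : ∀ x ∈ U, u x < -C / (1 - κ₁ * κ₂)

/-- The rescaled displacement `S̄ x = κ₁ (κ₁ - κ₂)² / (1 - κ₁κ₂) · S x`. -/
def rescaled (κ₁ κ₂ : ℝ) (S : Plane → Plane) (x : Plane) : Plane :=
  (κ₁ * (κ₁ - κ₂) ^ 2 / (1 - κ₁ * κ₂)) • S x

/-- The scalar profile
`φ(r) = (κ₁(1-κ₁κ₂) r + κ₁ √((κ₁-κ₂)² - (1-κ₂²)(κ₁²-1) r)) / (1 - r) + κ₁(1-κ₁κ₂)`,
used for `0 ≤ r < 1`. -/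
def profile (κ₁ κ₂ r : ℝ) : ℝ :=
  (κ₁ * (1 - κ₁ * κ₂) * r
      + κ₁ * √((κ₁ - κ₂) ^ 2 - (1 - κ₂ ^ 2) * (κ₁ ^ 2 - 1) * r)) / (1 - r)
    + κ₁ * (1 - κ₁ * κ₂)

/-- The map `G(y) = φ(|y|²) y`, used for `|y| < 1`. -/
def profileMap (κ₁ κ₂ : ℝ) (y : Plane) : Plane := profile κ₁ κ₂ (‖y‖ ^ 2) • y

/-- The right-hand side `F(x, z) = G(S̄ x / z)` of the imaging PDE solved for the gradient,
`Dv(x) = F(x, v(x))`, in the unknown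
`v = (u + C / (1 - κ₁κ₂)) (κ₁ - κ₂) √(κ₁² - 1)`. -/
def solvedField (κ₁ κ₂ : ℝ) (S : Plane → Plane) (x : Plane) (z : ℝ) : Plane :=
  profileMap κ₁ κ₂ (z⁻¹ • rescaled κ₁ κ₂ S x)

/-- The integrability condition of the system `Dv = F(x, v)` at the point `(x, z)`:
`∂F₁/∂x₂ + (∂F₁/∂z) F₂ = ∂F₂/∂x₁ + (∂F₂/∂z) F₁`. -/
def IntegrableAt (F : Plane → ℝ → Plane) (x : Plane) (z : ℝ) : Prop :=
  partialDeriv 1 (fun y => F y z 0) x + deriv (fun t => F x t 0) z * F x z 1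
    = partialDeriv 0 (fun y => F y z 1) x + deriv (fun t => F x t 1) z * F x z 0

end ImagingLens

end

/-! ### Gronwall, Picard–Lindelöf and uniform differentiability -/

noncomputable section

open Metric Function
open scoped NNReal

/-! In the unknown `v`, a positive multiple of `u + C / (1 - κ₁κ₂)`, the imaging PDE becomes the
total differential equation `Dv = F(x, v)`. The relation between `Du` and `S̄ x / v` is radial and
reduces to a quadratic equation for one positive scalar; `φ` is its admissible root
(`Admissible.smul_eq_smul_iff`, `Admissible.imagingPDEAt_iff`).

Such equations are solvable when the derivative of `F` along its own graph is symmetric. `F` and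
`∂F/∂z` are both parallel to `S̄ x`, so the `z`-terms cancel and the antisymmetric part is a nonzero
multiple of `φ a + 2 φ' (c/z)² b`, where `a = -curl S`, `b` is half of `S × D(|S|²)` and `S̄ = c S`
(`inner_solvedFieldDeriv_rescaled_sub`). The curl conditions therefore give integrability, and
`exists_hasFDerivAt_of_integrable` (Frobenius) and `eqOn_of_hasFDerivAt` give existence and
uniqueness.

For the converse, fix `x` and vary `z`. If `S̄ x ≠ 0`, eliminating `z` in favor of the radical `q`
turns integrability into a quadratic equation in `q` with coefficients independent of `z`. It has
three distinct roots, so `a = b = 0` (`Admissible.curlConditions_of_integrableAt`). If `S̄ x = 0`,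
then `b = 0` trivially and a single `z` gives `a = 0`. -/

theorem gronwallBound_zero_mul (K ε c x : ℝ) :
    gronwallBound 0 K (ε * c) x = gronwallBound 0 K ε x * c := by
  unfold gronwallBound
  split_ifs <;> ring

theorem gronwallBound_nonneg {δ K ε x : ℝ} (hδ : 0 ≤ δ) (hK : 0 ≤ K) (hε : 0 ≤ ε) (hx : 0 ≤ x) :
    0 ≤ gronwallBound δ K ε x := by
  calc 0 ≤ gronwallBound δ K ε 0 := by rwa [gronwallBound_x0]
    _ ≤ _ := gronwallBound_mono hδ hε hK hx

/-- The Picard-Lindelöf theorem, recording that the solution stays in the ball. -/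
theorem IsPicardLindelof.exists_hasDerivWithinAt_mem_closedBall
    {E : Type*} [NormedAddCommGroup E] [NormedSpace ℝ E] [CompleteSpace E]
    {f : ℝ → E → E} {tmin tmax : ℝ} {t₀ : Icc tmin tmax} {x₀ : E} {a L K : ℝ≥0}
    (hf : IsPicardLindelof f t₀ x₀ a 0 L K) :
    ∃ α : ℝ → E, α t₀ = x₀ ∧ (∀ t, α t ∈ closedBall x₀ a) ∧
      ∀ t ∈ Icc tmin tmax, HasDerivWithinAt α (f t (α t)) (Icc tmin tmax) t := by
  have hx : x₀ ∈ closedBall x₀ ((0 : ℝ≥0) : ℝ) := mem_closedBall_self le_rfl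
  obtain ⟨α, hα⟩ := ODE.FunSpace.exists_isFixedPt_next hf hx
  refine ⟨α.compProj, by rw [ODE.FunSpace.compProj_val, ← hα, ODE.FunSpace.next_apply₀],
    fun t ↦ α.compProj_mem_closedBall hf.mul_max_le, fun t ht ↦ ?_⟩
  apply ODE.hasDerivWithinAt_picard_Icc t₀.2 hf.continuousOn_uncurry
    α.continuous_compProj.continuousOn (fun _ ht' ↦ α.compProj_mem_closedBall hf.mul_max_le)
    x₀ ht |>.congr_of_mem _ ht
  intro t' ht'
  nth_rw 1 [← hα]
  rw [ODE.FunSpace.compProj_of_mem ht', ODE.FunSpace.next_apply]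

/-- A `C¹` map is uniformly differentiable on compact convex sets. -/
theorem IsCompact.exists_forall_norm_sub_sub_fderiv_le
    {E F : Type*} [NormedAddCommGroup E] [NormedSpace ℝ E] [NormedAddCommGroup F] [NormedSpace ℝ F]
    {f : E → F} {K : Set E} (hK : IsCompact K) (hKc : Convex ℝ K)
    (hf : ∀ p ∈ K, DifferentiableAt ℝ f p) (hf' : ContinuousOn (fderiv ℝ f) K)
    {ε : ℝ} (hε : 0 < ε) :
    ∃ η > 0, ∀ p ∈ K, ∀ q ∈ K, ‖q - p‖ < η →
      ‖f q - f p - fderiv ℝ f p (q - p)‖ ≤ ε * ‖q - p‖ := by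
  obtain ⟨η, hη, h⟩ := Metric.uniformContinuousOn_iff.1
    (hK.uniformContinuousOn_of_continuous hf') ε hε
  refine ⟨η, hη, fun p hp q hq hpq ↦ ?_⟩
  have hsub : segment ℝ p q ⊆ K := hKc.segment_subset hp hq
  -- Mean value inequality for `f - f'(p)` on the segment, where `f'` varies by less than `ε`.
  refine Convex.norm_image_sub_le_of_norm_hasFDerivWithin_le' (s := segment ℝ p q)
    (fun x hx ↦ (hf x (hsub hx)).hasFDerivAt.hasFDerivWithinAt) (fun x hx ↦ ?_)
    (convex_segment p q) (left_mem_segment ℝ p q) (right_mem_segment ℝ p q)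
  rw [← dist_eq_norm]
  refine (h x (hsub hx) p hp ?_).le
  rw [dist_comm, dist_eq_norm]
  rw [segment_eq_image'] at hx
  obtain ⟨θ, hθ, rfl⟩ := hx
  calc ‖p - (p + θ • (q - p))‖ = |θ| * ‖q - p‖ := by
        rw [sub_add_cancel_left, norm_neg, norm_smul, Real.norm_eq_abs]
    _ ≤ 1 * ‖q - p‖ := by
        gcongr
        rw [abs_le]; constructor <;> linarith [hθ.1, hθ.2]
    _ < η := by linarith

theorem IsCompact.exists_norm_fderiv_le
    {E F : Type*} [NormedAddCommGroup E] [NormedSpace ℝ E] [NormedAddCommGroup F] [NormedSpace ℝ F]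
    {f : E → F} {K : Set E} (hK : IsCompact K) (hf' : ContinuousOn (fderiv ℝ f) K) :
    ∃ L, ∀ p ∈ K, ‖fderiv ℝ f p‖ ≤ L :=
  hK.exists_bound_of_continuousOn hf'

/-! ### Frobenius theorem by integration along rays -/

section Frobenius

variable {E : Type*} [NormedAddCommGroup E] [NormedSpace ℝ E]

/-- `w` solves, on `[0, 1]`, the restriction of `Dv = A(x, v)` to the ray `x₀ + t h`, inside `K`. -/
structure IsRaySolution (A : E × ℝ → E →L[ℝ] ℝ) (K : Set (E × ℝ)) (x₀ h : E) (w : ℝ → ℝ) :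
    Prop where
  mem : ∀ t ∈ Icc (0 : ℝ) 1, (x₀ + t • h, w t) ∈ K
  deriv : ∀ t ∈ Icc (0 : ℝ) 1, HasDerivWithinAt w (A (x₀ + t • h, w t) h) (Icc 0 1) t

variable {A : E × ℝ → E →L[ℝ] ℝ} {K : Set (E × ℝ)} {x₀ h k : E} {w w₁ w₂ : ℝ → ℝ} {M L r : ℝ}

theorem IsRaySolution.hasDerivWithinAt_Ici (hw : IsRaySolution A K x₀ h w) {t : ℝ}
    (ht : t ∈ Ico (0 : ℝ) 1) : HasDerivWithinAt w (A (x₀ + t • h, w t) h) (Ici t) t :=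
  (hw.deriv t (Ico_subset_Icc_self ht)).mono_of_mem_nhdsWithin (Icc_mem_nhdsGE_of_mem ht)

theorem IsRaySolution.continuousOn (hw : IsRaySolution A K x₀ h w) : ContinuousOn w (Icc 0 1) :=
  fun t ht ↦ (hw.deriv t ht).continuousWithinAt

/-- On the degenerate ray the ODE has zero right-hand side; this yields the initial value of the
solution assembled from the rays. -/
theorem IsRaySolution.eq_of_zero (hw : IsRaySolution A K x₀ 0 w) : w 1 = w 0 := by
  have := eq_zero_of_abs_deriv_le_mul_abs_self_of_eq_zero_right (K := 0) (a := 0) (b := 1)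
    (f := fun t ↦ w t - w 0) (f' := fun _ ↦ 0)
    (hw.continuousOn.sub continuousOn_const)
    (fun t ht ↦ by simpa using (hw.hasDerivWithinAt_Ici ht).sub_const (w 0))
    (by simp) (by simp) 1 (by simp)
  linarith

/-- Ray solutions depend in a Lipschitz way on the direction. -/
theorem IsRaySolution.abs_sub_le (h₁ : IsRaySolution A K x₀ h w₁)
    (h₂ : IsRaySolution A K x₀ (h + k) w₂) (h0 : w₂ 0 = w₁ 0) (hL0 : 0 ≤ L) (hM0 : 0 ≤ M)
    (hM : ∀ p ∈ K, ‖A p‖ ≤ M) (hL : ∀ p ∈ K, ∀ q ∈ K, ‖A q - A p‖ ≤ L * ‖q - p‖)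
    (hr : ‖h + k‖ ≤ r) {t : ℝ} (ht : t ∈ Icc (0 : ℝ) 1) :
    |w₂ t - w₁ t| ≤ gronwallBound 0 (L * r) (L * r + M) 1 * ‖k‖ := by
  have hr0 : 0 ≤ r := (norm_nonneg _).trans hr
  have key := norm_le_gronwallBound_of_norm_deriv_right_le (a := 0) (b := 1) (δ := 0)
    (K := L * r) (ε := (L * r + M) * ‖k‖)
    (f := fun t ↦ w₂ t - w₁ t)
    (h₂.continuousOn.sub h₁.continuousOn)
    (fun s hs ↦ (h₂.hasDerivWithinAt_Ici hs).sub (h₁.hasDerivWithinAt_Ici hs))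
    (by simp [h0]) (fun s hs ↦ ?_) t ht
  · rw [gronwallBound_zero_mul, Real.norm_eq_abs, sub_zero] at key
    refine key.trans ?_
    gcongr
    exact gronwallBound_mono le_rfl (by positivity) (by positivity) ht.2
  · have hs' := Ico_subset_Icc_self hs
    have hp := h₁.mem s hs'
    have hq := h₂.mem s hs'
    set p := (x₀ + s • h, w₁ s)
    set q := (x₀ + s • (h + k), w₂ s)
    have hqp : ‖q - p‖ ≤ ‖k‖ + |w₂ s - w₁ s| := by
      have : q - p = (s • k, w₂ s - w₁ s) := by
        simp [p, q, smul_add]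
      rw [this]
      refine (Prod.norm_def _).trans_le (max_le ?_ ?_)
      · have : ‖s • k‖ ≤ 1 * ‖k‖ := by
          rw [norm_smul, Real.norm_eq_abs, abs_of_nonneg hs.1]
          gcongr; exact hs.2.le
        have := abs_nonneg (w₂ s - w₁ s)
        linarith
      · simp
    calc ‖A q (h + k) - A p h‖ = ‖(A q - A p) (h + k) + A p k‖ := by
          congr 1; simp only [map_add, sub_apply]; ring
      _ ≤ ‖A q - A p‖ * ‖h + k‖ + ‖A p‖ * ‖k‖ :=
          (norm_add_le _ _).trans (add_le_add ((A q - A p).le_opNorm _) ((A p).le_opNorm _))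
      _ ≤ (L * (‖k‖ + |w₂ s - w₁ s|)) * r + M * ‖k‖ := by
          gcongr
          · exact (hL p hp q hq).trans (by gcongr)
          · exact hM p hp
      _ = _ := by rw [Real.norm_eq_abs]; ring

/-- First order expansion of ray solutions in the direction, under the integrability condition. -/
theorem IsRaySolution.abs_sub_sub_le (h₁ : IsRaySolution A K x₀ h w₁)
    (h₂ : IsRaySolution A K x₀ (h + k) w₂) (h0 : w₂ 0 = w₁ 0) (hL0 : 0 ≤ L)
    (hA : ∀ p ∈ K, DifferentiableAt ℝ A p) (hA' : ∀ p ∈ K, ‖fderiv ℝ A p‖ ≤ L)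
    (hsymm : ∀ p ∈ K, fderiv ℝ A p (h, A p h) k = fderiv ℝ A p (k, A p k) h)
    (hr : ‖h + k‖ ≤ r) (hr' : ‖h‖ ≤ r) {C ε : ℝ} (hC : 1 ≤ C)
    (hw : ∀ t ∈ Icc (0 : ℝ) 1, |w₂ t - w₁ t| ≤ C * ‖k‖) (hkε : ‖k‖ ≤ ε)
    (hε : ∀ p ∈ K, ∀ q ∈ K, ‖q - p‖ ≤ C * ‖k‖ →
      ‖A q - A p - fderiv ℝ A p (q - p)‖ ≤ ε * ‖q - p‖) :
    |w₂ 1 - w₁ 1 - A (x₀ + h, w₁ 1) k| ≤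
      gronwallBound 0 (L * r) (C * r + L * C) 1 * (ε * ‖k‖) := by
  have hr0 : 0 ≤ r := (norm_nonneg _).trans hr
  have hε0 : 0 ≤ ε := (norm_nonneg _).trans hkε
  have hpd : ∀ t ∈ Icc (0 : ℝ) 1, HasDerivWithinAt (fun t ↦ t * A (x₀ + t • h, w₁ t) k)
      (A (x₀ + t • h, w₁ t) k + t * fderiv ℝ A (x₀ + t • h, w₁ t) (h, A (x₀ + t • h, w₁ t) h) k)
      (Icc 0 1) t := by
    intro t ht
    have h1 : HasDerivWithinAt (fun t : ℝ ↦ (x₀ + t • h, w₁ t)) (h, A (x₀ + t • h, w₁ t) h)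
        (Icc 0 1) t := by
      refine HasDerivWithinAt.prodMk ?_ (h₁.deriv t ht)
      simpa using ((hasDerivWithinAt_id t (Icc 0 1)).smul_const h).const_add x₀
    have h2 := (hA _ (h₁.mem t ht)).hasFDerivAt.comp_hasDerivWithinAt t h1
    have h3 := ((ContinuousLinearMap.apply ℝ ℝ k).hasFDerivAt).comp_hasDerivWithinAt t h2
    simpa [Function.comp_def] using (hasDerivWithinAt_id t (Icc 0 1)).fun_mul h3
  -- The expected first variation at time `t` is `t A k`. Gronwall bounds the error of this guess,
  -- so no theorem on differentiable dependence on parameters is needed.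
  have key := norm_le_gronwallBound_of_norm_deriv_right_le (a := 0) (b := 1) (δ := 0)
    (K := L * r) (ε := (C * r + L * C) * (ε * ‖k‖))
    (f := fun t ↦ w₂ t - w₁ t - t * A (x₀ + t • h, w₁ t) k)
    ((h₂.continuousOn.sub h₁.continuousOn).sub fun t ht ↦ (hpd t ht).continuousWithinAt)
    (fun s hs ↦ ((h₂.hasDerivWithinAt_Ici hs).sub (h₁.hasDerivWithinAt_Ici hs)).sub
      ((hpd s (Ico_subset_Icc_self hs)).mono_of_mem_nhdsWithin (Icc_mem_nhdsGE_of_mem hs)))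
    (by simp [h0]) (fun s hs ↦ ?_) 1 (by simp)
  · simpa [gronwallBound_zero_mul] using key
  · have hs' := Ico_subset_Icc_self hs
    have hp := h₁.mem s hs'
    have hq := h₂.mem s hs'
    have hws := hw s hs'
    set p := (x₀ + s • h, w₁ s)
    set q := (x₀ + s • (h + k), w₂ s)
    set e := w₂ s - w₁ s - s * A p k
    have hqp' : q - p = (s • k, w₂ s - w₁ s) := by
      simp [p, q, smul_add]
    have hqp : ‖q - p‖ ≤ C * ‖k‖ := by
      rw [hqp']
      refine (Prod.norm_def _).trans_le (max_le ?_ hws)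
      rw [norm_smul, Real.norm_eq_abs, abs_of_nonneg hs.1]
      gcongr; exact hs.2.le.trans hC
    have hqp2 : q - p = s • (k, A p k) + ((0 : E), e) := by
      rw [hqp']; simp [e]
    have hRb : ‖A q - A p - fderiv ℝ A p (q - p)‖ ≤ ε * (C * ‖k‖) :=
      (hε p hp q hq hqp).trans (by gcongr)
    set R := A q - A p - fderiv ℝ A p (q - p) with hR
    -- Integrability replaces `s A'(h, A h) k` by `s A'(k, A k) h`, which cancels the main part of
    -- `A'(q - p) h`. Only remainders and a term linear in the error `e` survive.
    have hexp : A q (h + k) - A p h - (A p k + s * fderiv ℝ A p (h, A p h) k)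
        = R (h + k) + fderiv ℝ A p (q - p) k + fderiv ℝ A p (0, e) h := by
      have : fderiv ℝ A p (q - p) h = s * fderiv ℝ A p (k, A p k) h + fderiv ℝ A p (0, e) h := by
        rw [hqp2, map_add, map_smul]; simp
      rw [hsymm p hp]
      simp only [hR, sub_apply, map_add]
      linarith
    rw [hexp]
    have b1 : ‖R (h + k)‖ ≤ ε * (C * ‖k‖) * r :=
      (R.le_opNorm _).trans (by gcongr)
    -- This term is quadratic in `k`; one factor `‖k‖` is traded for `ε`.
    have b2 : ‖fderiv ℝ A p (q - p) k‖ ≤ L * (C * ‖k‖) * ε := by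
      refine ((fderiv ℝ A p (q - p)).le_opNorm _).trans ?_
      gcongr
      exact ((fderiv ℝ A p).le_opNorm _).trans (mul_le_mul (hA' p hp) hqp (norm_nonneg _) hL0)
    have b3 : ‖fderiv ℝ A p (0, e) h‖ ≤ L * ‖e‖ * r := by
      refine ((fderiv ℝ A p (0, e)).le_opNorm _).trans ?_
      gcongr
      refine ((fderiv ℝ A p).le_opNorm _).trans ?_
      gcongr
      · exact hA' p hp
      · simp [Prod.norm_def]
    calc _ ≤ _ := norm_add₃_le
      _ ≤ ε * (C * ‖k‖) * r + L * (C * ‖k‖) * ε + L * ‖e‖ * r := by gcongr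
      _ = _ := by ring

/-- **Frobenius theorem** for the total differential equation `Dv = A(x, v)`: under the
integrability condition it has local solutions with prescribed initial value. -/
theorem exists_hasFDerivAt_of_integrable [ProperSpace E] {W : Set (E × ℝ)} (hW : IsOpen W)
    (hA : ContDiffOn ℝ 1 A W)
    (hsymm : ∀ p ∈ W, ∀ h k, fderiv ℝ A p (h, A p h) k = fderiv ℝ A p (k, A p k) h)
    {z₀ : ℝ} (h₀ : (x₀, z₀) ∈ W) :
    ∃ r > 0, ∃ v : E → ℝ, v x₀ = z₀ ∧
      ∀ x ∈ ball x₀ r, (x, v x) ∈ W ∧ HasFDerivAt v (A (x, v x)) x := by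
  obtain ⟨a, ha, haW⟩ := Metric.nhds_basis_closedBall.mem_iff.1 (hW.mem_nhds h₀)
  set K := closedBall (x₀, z₀) a with hKdef
  have hK : IsCompact K := isCompact_closedBall _ _
  have hKc : Convex ℝ K := convex_closedBall _ _
  have hAd : ∀ p ∈ K, DifferentiableAt ℝ A p := fun p hp ↦
    (hA.differentiableOn one_ne_zero).differentiableAt (hW.mem_nhds (haW hp))
  have hA'c : ContinuousOn (fderiv ℝ A) K :=
    (hA.continuousOn_fderiv_of_isOpen hW le_rfl).mono haW
  obtain ⟨M, hM⟩ := hK.exists_bound_of_continuousOn (hA.continuousOn.mono haW)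
  obtain ⟨L, hL⟩ := hK.exists_norm_fderiv_le hA'c
  have hcen : (x₀, z₀) ∈ K := mem_closedBall_self ha.le
  have hM0 : 0 ≤ M := (norm_nonneg _).trans (hM _ hcen)
  have hL0 : 0 ≤ L := (norm_nonneg _).trans (hL _ hcen)
  have hLip : ∀ p ∈ K, ∀ q ∈ K, ‖A q - A p‖ ≤ L * ‖q - p‖ := fun p hp q hq ↦
    hKc.norm_image_sub_le_of_norm_fderiv_le hAd hL hp hq
  -- `r ≤ a` keeps the rays in the ball and `M r ≤ a` keeps the solutions there; the denominator `M
  -- + 1` covers `M = 0`.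
  obtain ⟨r, hr, hra, hrM⟩ : ∃ r > 0, r ≤ a ∧ M * r ≤ a := by
    refine ⟨min a (a / (M + 1)), by positivity, min_le_left _ _, ?_⟩
    calc M * min a (a / (M + 1)) ≤ (M + 1) * (a / (M + 1)) := by
          gcongr
          · linarith
          · exact min_le_right _ _
      _ = a := by field_simp
  have hmemK : ∀ h : E, ‖h‖ ≤ r → ∀ t ∈ Icc (0 : ℝ) 1, ∀ z ∈ closedBall z₀ a,
      (x₀ + t • h, z) ∈ K := by
    intro h hh t ht z hz
    rw [hKdef, ← closedBall_prod_same]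
    refine ⟨?_, hz⟩
    rw [mem_closedBall, dist_eq_norm, add_sub_cancel_left, norm_smul, Real.norm_eq_abs,
      abs_of_nonneg ht.1]
    calc t * ‖h‖ ≤ 1 * r := by gcongr; exact ht.2
      _ ≤ a := by linarith
  have hex : ∀ h : E, ‖h‖ ≤ r → ∃ w, IsRaySolution A K x₀ h w ∧ w 0 = z₀ := by
    intro h hh
    have hpl : IsPicardLindelof (fun t z ↦ A (x₀ + t • h, z) h)
        (⟨0, by simp⟩ : Icc (0 : ℝ) 1) z₀ ⟨a, ha.le⟩ 0 ⟨M * r, by positivity⟩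
        ⟨L * r, by positivity⟩ := by
      refine ⟨fun t ht ↦ LipschitzOnWith.of_dist_le_mul fun z hz y hy ↦ ?_,
        fun z hz ↦ ?_, fun t ht z hz ↦ ?_, ?_⟩
      · rw [dist_eq_norm, dist_eq_norm, ← sub_apply]
        have h1 := hLip _ (hmemK h hh t ht y hy) _ (hmemK h hh t ht z hz)
        have h2 : ‖(x₀ + t • h, z) - (x₀ + t • h, y)‖ = ‖z - y‖ := by
          simp [Prod.norm_def]
        rw [h2] at h1
        calc _ ≤ _ := ContinuousLinearMap.le_opNorm _ _
          _ ≤ (L * ‖z - y‖) * r := by gcongr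
          _ = (L * r) * ‖z - y‖ := by ring
      · have : ContinuousOn (fun t : ℝ ↦ A (x₀ + t • h, z)) (Icc 0 1) :=
          (hA.continuousOn.mono haW).comp (by fun_prop) fun t ht ↦ hmemK h hh t ht z hz
        exact this.clm_apply continuousOn_const
      · calc _ ≤ _ := ContinuousLinearMap.le_opNorm _ _
          _ ≤ M * r := by gcongr; exact hM _ (hmemK h hh t ht z hz)
      · change M * r * max (1 - 0) (0 - 0) ≤ a - 0
        simpa using hrM
    obtain ⟨w, hw0, hwm, hwd⟩ := hpl.exists_hasDerivWithinAt_mem_closedBall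
    exact ⟨w, ⟨fun t ht ↦ hmemK h hh t ht _ (hwm t), hwd⟩, hw0⟩
  choose! w hw hw0 using hex
  -- The solution at `x` is the time-one value along the ray from `x₀` to `x`.
  refine ⟨r, hr, fun x ↦ w (x - x₀) 1, ?_, fun x hx ↦ ?_⟩
  · have h0 : ‖(0 : E)‖ ≤ r := by simpa using hr.le
    simpa [hw0 0 h0] using (hw 0 h0).eq_of_zero
  have hxr : ‖x - x₀‖ < r := by rwa [← dist_eq_norm]
  have hsol := hw _ hxr.le
  have hx1 : x₀ + (x - x₀) = x := by abel
  refine ⟨haW (by simpa [hx1] using hsol.mem 1 (by simp)), ?_⟩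
  -- The summand `1` lets `C ‖k‖` bound the displacement in the base as well as in the value.
  set C := 1 + gronwallBound 0 (L * r) (L * r + M) 1 with hCdef
  have hC : 1 ≤ C := by
    linarith [gronwallBound_nonneg (δ := 0) (K := L * r) (ε := L * r + M) (x := 1) le_rfl
      (by positivity) (by positivity) zero_le_one]
  set B := gronwallBound 0 (L * r) (C * r + L * C) 1 with hBdef
  have hB : 0 ≤ B := gronwallBound_nonneg le_rfl (by positivity) (by positivity) zero_le_one
  rw [hasFDerivAt_iff_isLittleO_nhds_zero, Asymptotics.isLittleO_iff]
  intro c hc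
  set ε := c / (B + 1) with hεdef
  have hε : 0 < ε := by positivity
  obtain ⟨η, hη, hunif⟩ := hK.exists_forall_norm_sub_sub_fderiv_le hKc hAd hA'c hε
  have e1 : ∀ᶠ k : E in 𝓝 0, ‖k‖ < r - ‖x - x₀‖ :=
    (continuous_norm.tendsto' (0 : E) 0 norm_zero).eventually_lt_const (by linarith)
  have e2 : ∀ᶠ k : E in 𝓝 0, ‖k‖ < ε :=
    (continuous_norm.tendsto' (0 : E) 0 norm_zero).eventually_lt_const hε
  have e3 : ∀ᶠ k : E in 𝓝 0, ‖k‖ < η / C :=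
    (continuous_norm.tendsto' (0 : E) 0 norm_zero).eventually_lt_const (by positivity)
  filter_upwards [e1, e2, e3] with k hk1 hk2 hk3
  have hxk : ‖(x - x₀) + k‖ ≤ r := (norm_add_le _ _).trans (by linarith)
  have hsolk := hw _ hxk
  have h00 : w ((x - x₀) + k) 0 = w (x - x₀) 0 := by rw [hw0 _ hxk, hw0 _ hxr.le]
  have hΔ : ∀ t ∈ Icc (0 : ℝ) 1, |w ((x - x₀) + k) t - w (x - x₀) t| ≤ C * ‖k‖ := fun t ht ↦
    (hsol.abs_sub_le hsolk h00 hL0 hM0 hM hLip hxk ht).trans (by gcongr; linarith)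
  have hCk : C * ‖k‖ < η := by
    rw [lt_div_iff₀ (by linarith)] at hk3; linarith
  have := hsol.abs_sub_sub_le hsolk h00 hL0 hAd hL (fun p hp ↦ hsymm p (haW hp) _ _) hxk hxr.le
    hC hΔ hk2.le (fun p hp q hq hpq ↦ hunif p hp q hq (hpq.trans_lt hCk))
  have hxx : x + k - x₀ = (x - x₀) + k := by abel
  rw [hx1] at this
  rw [hxx, Real.norm_eq_abs]
  refine this.trans ?_
  calc B * (ε * ‖k‖) ≤ (B + 1) * (ε * ‖k‖) := by gcongr; linarith
    _ = c * ‖k‖ := by rw [hεdef]; field_simp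

/-- Solutions of `Dv = A(x, v)` on a convex set are determined by their value at one point. -/
theorem eqOn_of_hasFDerivAt {W : Set (E × ℝ)} (hW : IsOpen W) (hA : ContDiffOn ℝ 1 A W)
    {U : Set E} (hU : Convex ℝ U) (hx₀ : x₀ ∈ U) {v₁ v₂ : E → ℝ}
    (h₁ : ∀ x ∈ U, (x, v₁ x) ∈ W ∧ HasFDerivAt v₁ (A (x, v₁ x)) x)
    (h₂ : ∀ x ∈ U, (x, v₂ x) ∈ W ∧ HasFDerivAt v₂ (A (x, v₂ x)) x)
    (h₀ : v₁ x₀ = v₂ x₀) : EqOn v₁ v₂ U := by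
  intro x hx
  set h := x - x₀
  have hγ : ∀ t ∈ Icc (0 : ℝ) 1, x₀ + t • h ∈ U := fun t ht ↦
    hU.add_smul_sub_mem hx₀ hx ht
  have hγd : ∀ t : ℝ, HasDerivAt (fun t : ℝ ↦ x₀ + t • h) h t := fun t ↦ by
    simpa using ((hasDerivAt_id t).smul_const h).const_add x₀
  have hd : ∀ v : E → ℝ, (∀ x ∈ U, (x, v x) ∈ W ∧ HasFDerivAt v (A (x, v x)) x) →
      ∀ t ∈ Icc (0 : ℝ) 1, HasDerivAt (fun t : ℝ ↦ v (x₀ + t • h))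
        (A (x₀ + t • h, v (x₀ + t • h)) h) t := fun v hv t ht ↦
    (hv _ (hγ t ht)).2.comp_hasDerivAt t (hγd t)
  set curve : (E → ℝ) → ℝ → E × ℝ := fun v t ↦ (x₀ + t • h, v (x₀ + t • h))
  have hcurve : ∀ v : E → ℝ, (∀ x ∈ U, (x, v x) ∈ W ∧ HasFDerivAt v (A (x, v x)) x) →
      IsCompact (curve v '' Icc 0 1) ∧ curve v '' Icc 0 1 ⊆ W := by
    intro v hv
    refine ⟨isCompact_Icc.image_of_continuousOn fun t ht ↦
      ((hγd t).continuousAt.prodMk (hd v hv t ht).continuousAt).continuousWithinAt, ?_⟩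
    rintro _ ⟨t, ht, rfl⟩
    exact (hv _ (hγ t ht)).1
  -- `A` is only locally Lipschitz on `W`; compactness of the two graphs over the segment gives one
  -- constant for both.
  obtain ⟨K, hK⟩ := LocallyLipschitzOn.exists_lipschitzOnWith_of_compact (f := A)
    ((hcurve v₁ h₁).1.union (hcurve v₂ h₂).1) (by
      intro p hp
      have hpW : p ∈ W := union_subset (hcurve v₁ h₁).2 (hcurve v₂ h₂).2 hp
      obtain ⟨K, t, ht, hl⟩ := (hA.contDiffAt (hW.mem_nhds hpW)).exists_lipschitzOnWith
      exact ⟨K, t, mem_nhdsWithin_of_mem_nhds ht, hl⟩)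
  have key := eq_zero_of_abs_deriv_le_mul_abs_self_of_eq_zero_right (K := K * ‖h‖)
    (a := 0) (b := 1) (f := fun t : ℝ ↦ v₁ (x₀ + t • h) - v₂ (x₀ + t • h))
    (fun t ht ↦ ((hd v₁ h₁ t ht).sub (hd v₂ h₂ t ht)).continuousAt.continuousWithinAt)
    (fun t ht ↦ ((hd v₁ h₁ t (Ico_subset_Icc_self ht)).sub
      (hd v₂ h₂ t (Ico_subset_Icc_self ht))).hasDerivWithinAt)
    (by simp [h₀]) (fun t ht ↦ ?_) 1 (by simp)
  · simpa [h, sub_eq_zero] using key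
  · have ht' := Ico_subset_Icc_self ht
    have := hK.dist_le_mul _ (Or.inl ⟨t, ht', rfl⟩) _ (Or.inr ⟨t, ht', rfl⟩)
    rw [dist_eq_norm, dist_eq_norm] at this
    have hn : ‖curve v₁ t - curve v₂ t‖ = ‖v₁ (x₀ + t • h) - v₂ (x₀ + t • h)‖ := by
      simp [curve, Prod.norm_def]
    rw [hn] at this
    calc ‖A (curve v₁ t) h - A (curve v₂ t) h‖ ≤ ‖A (curve v₁ t) - A (curve v₂ t)‖ * ‖h‖ := by
          rw [← sub_apply]
          exact ContinuousLinearMap.le_opNorm _ _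
      _ ≤ (K * ‖v₁ (x₀ + t • h) - v₂ (x₀ + t • h)‖) * ‖h‖ := by gcongr
      _ = _ := by ring

end Frobenius

end

/-! ### The profile, its derivative, and the solved field -/

noncomputable section

namespace ImagingLens

open scoped RealInnerProductSpace

/-- The inequalities satisfied by the ratios of the refractive indices. -/
structure Admissible (κ₁ κ₂ : ℝ) : Prop where
  one_lt : 1 < κ₁
  pos : 0 < κ₂
  lt_one : κ₂ < 1
  mul_lt_one : κ₁ * κ₂ < 1

/-- The square root appearing in `profile`. -/
def radical (κ₁ κ₂ r : ℝ) : ℝ := √((κ₁ - κ₂) ^ 2 - (1 - κ₂ ^ 2) * (κ₁ ^ 2 - 1) * r)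

variable {κ₁ κ₂ r : ℝ}

theorem Admissible.diff_pos (h : Admissible κ₁ κ₂) : 0 < κ₁ - κ₂ := by
  linarith [h.one_lt, h.lt_one]

theorem Admissible.one_sub_mul_pos (h : Admissible κ₁ κ₂) : 0 < 1 - κ₁ * κ₂ := by
  linarith [h.mul_lt_one]

theorem Admissible.sq_sub_one_pos (h : Admissible κ₁ κ₂) : 0 < κ₁ ^ 2 - 1 := by
  nlinarith [h.one_lt]

theorem Admissible.coeff_pos (h : Admissible κ₁ κ₂) : 0 < (1 - κ₂ ^ 2) * (κ₁ ^ 2 - 1) :=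
  mul_pos (by nlinarith [h.pos, h.lt_one]) h.sq_sub_one_pos

/-- Since `(κ₁ - κ₂)² - (1 - κ₁κ₂)² = (1 - κ₂²)(κ₁² - 1)`, the two sides differ by `(1 - κ₂²)(κ₁² -
1)(1 - r)`. -/
theorem Admissible.sq_lt_radicand (h : Admissible κ₁ κ₂) (hr : r < 1) :
    (1 - κ₁ * κ₂) ^ 2 < (κ₁ - κ₂) ^ 2 - (1 - κ₂ ^ 2) * (κ₁ ^ 2 - 1) * r := by
  nlinarith [mul_pos h.coeff_pos (sub_pos.2 hr)]

theorem Admissible.radicand_pos (h : Admissible κ₁ κ₂) (hr : r < 1) :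
    0 < (κ₁ - κ₂) ^ 2 - (1 - κ₂ ^ 2) * (κ₁ ^ 2 - 1) * r :=
  (sq_nonneg _).trans_lt (h.sq_lt_radicand hr)

theorem Admissible.sq_radical (h : Admissible κ₁ κ₂) (hr : r < 1) :
    radical κ₁ κ₂ r ^ 2 = (κ₁ - κ₂) ^ 2 - (1 - κ₂ ^ 2) * (κ₁ ^ 2 - 1) * r :=
  Real.sq_sqrt (h.radicand_pos hr).le

theorem Admissible.lt_radical (h : Admissible κ₁ κ₂) (hr : r < 1) :
    1 - κ₁ * κ₂ < radical κ₁ κ₂ r :=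
  Real.lt_sqrt_of_sq_lt (h.sq_lt_radicand hr)

theorem Admissible.radical_pos (h : Admissible κ₁ κ₂) (hr : r < 1) : 0 < radical κ₁ κ₂ r :=
  Real.sqrt_pos.2 (h.radicand_pos hr)

theorem profile_eq (hr : r < 1) :
    profile κ₁ κ₂ r = κ₁ * (1 - κ₁ * κ₂ + radical κ₁ κ₂ r) / (1 - r) := by
  have : 1 - r ≠ 0 := by linarith
  simp only [profile, radical]
  field_simp
  ring

/-- Rationalizing cancels `1 - r`, so that `r` enters only through the radical. This makes the
derivative a multiple of the profile itself. -/
theorem Admissible.profile_eq_div (h : Admissible κ₁ κ₂) (hr : r < 1) :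
    profile κ₁ κ₂ r =
      κ₁ * ((1 - κ₂ ^ 2) * (κ₁ ^ 2 - 1)) / (radical κ₁ κ₂ r - (1 - κ₁ * κ₂)) := by
  rw [profile_eq hr, div_eq_div_iff (by linarith) (by linarith [h.lt_radical hr])]
  linear_combination κ₁ * h.sq_radical hr

theorem Admissible.profile_pos (h : Admissible κ₁ κ₂) (hr : r < 1) : 0 < profile κ₁ κ₂ r := by
  rw [profile_eq hr]
  have := h.radical_pos hr
  have := h.one_sub_mul_pos
  have := h.one_lt
  exact div_pos (by positivity) (by linarith)

theorem Admissible.contDiffAt_profile (h : Admissible κ₁ κ₂) (hr : r < 1) {n : WithTop ℕ∞} :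
    ContDiffAt ℝ n (profile κ₁ κ₂) r := by
  have h1 : ContDiffAt ℝ n (fun r ↦ √((κ₁ - κ₂) ^ 2 - (1 - κ₂ ^ 2) * (κ₁ ^ 2 - 1) * r)) r :=
    ContDiffAt.sqrt (by fun_prop) (h.radicand_pos hr).ne'
  have h2 : 1 - r ≠ 0 := by linarith
  unfold profile
  exact (((contDiffAt_const.mul contDiffAt_id).add (contDiffAt_const.mul h1)).div
    (contDiffAt_const.sub contDiffAt_id) h2).add contDiffAt_const

theorem Admissible.hasDerivAt_profile (h : Admissible κ₁ κ₂) (hr : r < 1) :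
    HasDerivAt (profile κ₁ κ₂) ((1 - κ₂ ^ 2) * (κ₁ ^ 2 - 1) * profile κ₁ κ₂ r /
      (2 * radical κ₁ κ₂ r * (radical κ₁ κ₂ r - (1 - κ₁ * κ₂)))) r := by
  have hq := (h.radical_pos hr).ne'
  have hqD : radical κ₁ κ₂ r - (1 - κ₁ * κ₂) ≠ 0 := by linarith [h.lt_radical hr]
  have h1 : HasDerivAt (radical κ₁ κ₂)
      (-((1 - κ₂ ^ 2) * (κ₁ ^ 2 - 1)) / (2 * radical κ₁ κ₂ r)) r := by
    have := (((hasDerivAt_id r).const_mul ((1 - κ₂ ^ 2) * (κ₁ ^ 2 - 1))).const_sub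
      ((κ₁ - κ₂) ^ 2)).sqrt (h.radicand_pos hr).ne'
    unfold radical
    simpa using this
  have h2 := ((h1.sub_const (1 - κ₁ * κ₂)).inv hqD).const_mul
    (κ₁ * ((1 - κ₂ ^ 2) * (κ₁ ^ 2 - 1)))
  have h3 : profile κ₁ κ₂ =ᶠ[𝓝 r] fun r ↦ κ₁ * ((1 - κ₂ ^ 2) * (κ₁ ^ 2 - 1)) *
      (radical κ₁ κ₂ r - (1 - κ₁ * κ₂))⁻¹ := by
    filter_upwards [Iio_mem_nhds hr] with s hs
    rw [h.profile_eq_div hs, div_eq_mul_inv]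
  refine (h2.congr_of_eventuallyEq h3).congr_deriv ?_
  rw [h.profile_eq_div hr]
  field_simp

theorem sq_norm_lt_one {y : Plane} (hy : ‖y‖ < 1) : ‖y‖ ^ 2 < 1 := by
  nlinarith [norm_nonneg y]

theorem Admissible.contDiffAt_profileMap (h : Admissible κ₁ κ₂) {y : Plane} (hy : ‖y‖ < 1)
    {n : WithTop ℕ∞} : ContDiffAt ℝ n (profileMap κ₁ κ₂) y := by
  have h1 : ContDiffAt ℝ n (fun y : Plane ↦ profile κ₁ κ₂ (‖y‖ ^ 2)) y :=
    (h.contDiffAt_profile (sq_norm_lt_one hy)).comp y (contDiff_norm_sq ℝ).contDiffAt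
  exact h1.smul contDiffAt_id

theorem Admissible.hasFDerivAt_profileMap (h : Admissible κ₁ κ₂) {y : Plane} (hy : ‖y‖ < 1) :
    HasFDerivAt (profileMap κ₁ κ₂) (profile κ₁ κ₂ (‖y‖ ^ 2) • ContinuousLinearMap.id ℝ Plane +
      ((2 * deriv (profile κ₁ κ₂) (‖y‖ ^ 2)) • innerSL ℝ y).smulRight y) y := by
  have h1 := (h.hasDerivAt_profile (sq_norm_lt_one hy)).differentiableAt.hasDerivAt
  have h2 := h1.comp_hasFDerivAt y (hasStrictFDerivAt_norm_sq y).hasFDerivAt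
  refine (h2.smul (hasFDerivAt_id y)).congr_fderiv ?_
  ext k i
  simp [mul_assoc]
  ring

/-! ### The solved field -/

theorem hasFDerivAt_inv_smul {S : Plane → Plane} {J : Plane →L[ℝ] Plane} {x : Plane} {z : ℝ}
    (hS : HasFDerivAt S J x) (hz : z ≠ 0) :
    HasFDerivAt (fun p : Plane × ℝ ↦ p.2⁻¹ • S p.1)
      (z⁻¹ • J ∘L ContinuousLinearMap.fst ℝ Plane ℝ +
        ((-(z ^ 2)⁻¹) • ContinuousLinearMap.snd ℝ Plane ℝ).smulRight (S x)) (x, z) := by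
  have h1 : HasFDerivAt (fun p : Plane × ℝ ↦ S p.1)
      (J ∘L ContinuousLinearMap.fst ℝ Plane ℝ) (x, z) :=
    HasFDerivAt.comp (x, z) hS hasFDerivAt_fst
  have h2 : HasFDerivAt (fun p : Plane × ℝ ↦ p.2⁻¹)
      ((-(z ^ 2)⁻¹) • ContinuousLinearMap.snd ℝ Plane ℝ) (x, z) :=
    (hasDerivAt_inv hz).comp_hasFDerivAt (x, z) hasFDerivAt_snd
  exact h2.smul h1

/-- The derivative of `(x, z) ↦ F(x, z)`, in terms of `y = S̄ x / z` and the derivative `J`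
of `S̄`. -/
def solvedFieldDeriv (κ₁ κ₂ : ℝ) (y : Plane) (J : Plane →L[ℝ] Plane) (z : ℝ) :
    Plane × ℝ →L[ℝ] Plane :=
  (profile κ₁ κ₂ (‖y‖ ^ 2) • ContinuousLinearMap.id ℝ Plane +
    ((2 * deriv (profile κ₁ κ₂) (‖y‖ ^ 2)) • innerSL ℝ y).smulRight y) ∘L
  (z⁻¹ • J ∘L ContinuousLinearMap.fst ℝ Plane ℝ -
    (z⁻¹ • ContinuousLinearMap.snd ℝ Plane ℝ).smulRight y)

variable {S : Plane → Plane} {x : Plane} {z : ℝ}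

theorem ne_zero_of_norm_lt_abs {y : Plane} (hz : ‖y‖ < |z|) : z ≠ 0 :=
  abs_pos.1 ((norm_nonneg _).trans_lt hz)

theorem norm_inv_smul_lt_one {y : Plane} (hz : ‖y‖ < |z|) : ‖z⁻¹ • y‖ < 1 := by
  rw [norm_smul, norm_inv, Real.norm_eq_abs, inv_mul_lt_one₀ ((norm_nonneg _).trans_lt hz)]
  exact hz

theorem Admissible.hasFDerivAt_solvedField (h : Admissible κ₁ κ₂) {J : Plane →L[ℝ] Plane}
    (hS : HasFDerivAt (rescaled κ₁ κ₂ S) J x) (hz : ‖rescaled κ₁ κ₂ S x‖ < |z|) :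
    HasFDerivAt (fun p : Plane × ℝ ↦ solvedField κ₁ κ₂ S p.1 p.2)
      (solvedFieldDeriv κ₁ κ₂ (z⁻¹ • rescaled κ₁ κ₂ S x) J z) (x, z) := by
  have h1 := h.hasFDerivAt_profileMap (norm_inv_smul_lt_one hz)
  have h2 := hasFDerivAt_inv_smul hS (ne_zero_of_norm_lt_abs hz)
  refine (HasFDerivAt.comp (x, z) h1 h2).congr_fderiv ?_
  unfold solvedFieldDeriv
  congr 1
  ext k i <;> simp [sq]
  ring

theorem Admissible.contDiffAt_solvedField (h : Admissible κ₁ κ₂) {n : WithTop ℕ∞}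
    (hS : ContDiffAt ℝ n S x) (hz : ‖rescaled κ₁ κ₂ S x‖ < |z|) :
    ContDiffAt ℝ n (fun p : Plane × ℝ ↦ solvedField κ₁ κ₂ S p.1 p.2) (x, z) := by
  have h1 := h.contDiffAt_profileMap (n := n) (norm_inv_smul_lt_one hz)
  have h2 : ContDiffAt ℝ n (fun p : Plane × ℝ ↦ rescaled κ₁ κ₂ S p.1) (x, z) :=
    contDiffAt_const.fun_smul (ContDiffAt.comp (x, z) hS contDiffAt_fst)
  have h3 : ContDiffAt ℝ n (fun p : Plane × ℝ ↦ p.2⁻¹) (x, z) :=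
    contDiffAt_snd.inv (ne_zero_of_norm_lt_abs hz)
  exact ContDiffAt.comp (x, z) h1 (h3.smul h2)

/-- The antisymmetric part of the derivative of the solved field along its own graph. -/
theorem inner_solvedFieldDeriv_sub (y h k : Plane) (J : Plane →L[ℝ] Plane) (z : ℝ) :
    ⟪solvedFieldDeriv κ₁ κ₂ y J z (h, ⟪profileMap κ₁ κ₂ y, h⟫), k⟫ -
      ⟪solvedFieldDeriv κ₁ κ₂ y J z (k, ⟪profileMap κ₁ κ₂ y, k⟫), h⟫ =
    z⁻¹ * (profile κ₁ κ₂ (‖y‖ ^ 2) * (⟪J h, k⟫ - ⟪J k, h⟫) +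
      2 * deriv (profile κ₁ κ₂) (‖y‖ ^ 2) * (⟪y, J h⟫ * ⟪y, k⟫ - ⟪y, J k⟫ * ⟪y, h⟫)) := by
  -- The `z`-derivative is a multiple of `y`, as is `profileMap κ₁ κ₂ y`, so its contribution is
  -- symmetric in `h` and `k` and drops out.
  simp [solvedFieldDeriv, profileMap, inner_add_left, inner_sub_left,
    inner_smul_left]
  ring

/-! ### Coordinates -/

theorem clm_apply_eq {F : Type*} [NormedAddCommGroup F] [NormedSpace ℝ F] (L : Plane →L[ℝ] F)
    (h : Plane) :
    L h = h 0 • L (EuclideanSpace.single 0 1) + h 1 • L (EuclideanSpace.single 1 1) := by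
  rw [← map_smul, ← map_smul, ← map_add]
  congr 1
  ext i
  fin_cases i <;> simp

theorem inner_eq (a b : Plane) : ⟪a, b⟫ = a 0 * b 0 + a 1 * b 1 := by
  simp [PiLp.inner_apply, Fin.sum_univ_two, mul_comm]

theorem gradient_apply (f : Plane → ℝ) (x : Plane) (i : Fin 2) :
    gradient f x i = partialDeriv i f x := by
  have : ⟪gradient f x, EuclideanSpace.single i (1 : ℝ)⟫ = partialDeriv i f x := by
    rw [gradient, InnerProductSpace.toDual_symm_apply, partialDeriv]
  rw [← this, EuclideanSpace.inner_single_right]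
  simp

theorem partialDeriv_coord {i j : Fin 2} {J : Plane →L[ℝ] Plane} (hS : HasFDerivAt S J x) :
    partialDeriv j (fun y ↦ S y i) x = J (EuclideanSpace.single j 1) i := by
  have := (EuclideanSpace.proj i : Plane →L[ℝ] ℝ).hasFDerivAt.comp x hS
  rw [partialDeriv, show (fun y ↦ S y i) = (EuclideanSpace.proj i : Plane →L[ℝ] ℝ) ∘ S from rfl,
    this.fderiv]
  rfl

theorem curlConditions_iff {J : Plane →L[ℝ] Plane} (hS : HasFDerivAt S J x) :
    CurlConditions S x ↔
      J (EuclideanSpace.single 1 1) 0 - J (EuclideanSpace.single 0 1) 1 = 0 ∧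
      S x 0 * ⟪S x, J (EuclideanSpace.single 1 1)⟫ -
        S x 1 * ⟪S x, J (EuclideanSpace.single 0 1)⟫ = 0 := by
  have h1 : ∀ j, partialDeriv j (fun y ↦ ‖S y‖ ^ 2) x =
      2 * ⟪S x, J (EuclideanSpace.single j 1)⟫ := by
    intro j
    rw [partialDeriv, hS.norm_sq.fderiv]
    simp
  rw [CurlConditions, curl, partialDeriv_coord hS, partialDeriv_coord hS, cross, gradient_apply,
    gradient_apply, h1, h1]
  constructor <;> rintro ⟨a, b⟩ <;> constructor <;> linarith

theorem integrableAt_iff {F : Plane → ℝ → Plane} {L : Plane × ℝ →L[ℝ] Plane}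
    (hF : HasFDerivAt (fun p : Plane × ℝ ↦ F p.1 p.2) L (x, z)) :
    IntegrableAt F x z ↔
      ⟪L (EuclideanSpace.single 1 1, ⟪F x z, EuclideanSpace.single 1 1⟫),
        EuclideanSpace.single 0 1⟫ -
      ⟪L (EuclideanSpace.single 0 1, ⟪F x z, EuclideanSpace.single 0 1⟫),
        EuclideanSpace.single 1 1⟫ = 0 := by
  have hx : HasFDerivAt (fun y ↦ F y z) (L ∘L ContinuousLinearMap.inl ℝ Plane ℝ) x :=
    HasFDerivAt.comp x (f := fun y ↦ (y, z)) hF (hasFDerivAt_prodMk_left x z)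
  have hz : ∀ i, deriv (fun t ↦ F x t i) z = L (0, 1) i := by
    intro i
    have h1 : HasDerivAt (fun t ↦ F x t) (L (0, 1)) z :=
      HasFDerivAt.comp_hasDerivAt (f := fun t : ℝ ↦ (x, t)) z hF
        ((hasDerivAt_const z x).prodMk (hasDerivAt_id z))
    exact ((EuclideanSpace.proj i : Plane →L[ℝ] ℝ).hasFDerivAt.comp_hasDerivAt z h1).deriv
  have hL : ∀ h t i, L (h, t) i = L (h, 0) i + t * L (0, 1) i := by
    intro h t i
    have : (h, t) = (h, (0 : ℝ)) + t • ((0 : Plane), (1 : ℝ)) := by simp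
    rw [this, map_add, map_smul]
    simp
  rw [IntegrableAt, partialDeriv_coord hx, partialDeriv_coord hx, hz, hz, sub_eq_zero]
  simp only [EuclideanSpace.inner_single_right, one_mul, conj_trivial]
  rw [hL _ (F x z 1), hL _ (F x z 0)]
  simp [mul_comm]

end ImagingLens

end

/-! ### Regularity, and integrability against the curl conditions -/

noncomputable section

/-- Solutions of `Dv = A(x, v)` with `A` of class `C¹` are of class `C²`. -/
theorem contDiffOn_two_of_hasFDerivAt {E : Type*} [NormedAddCommGroup E] [NormedSpace ℝ E]
    {A : E × ℝ → E →L[ℝ] ℝ} {W : Set (E × ℝ)} (hA : ContDiffOn ℝ 1 A W) {U : Set E}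
    (hU : IsOpen U) {v : E → ℝ} (h : ∀ x ∈ U, (x, v x) ∈ W ∧ HasFDerivAt v (A (x, v x)) x) :
    ContDiffOn ℝ 2 v U := by
  have hd : DifferentiableOn ℝ v U := fun x hx ↦
    (h x hx).2.differentiableAt.differentiableWithinAt
  have hmaps : MapsTo (fun x ↦ (x, v x)) U W := fun x hx ↦ (h x hx).1
  have heq : ∀ x ∈ U, fderiv ℝ v x = A (x, v x) := fun x hx ↦ (h x hx).2.fderiv
  have h1 : ContDiffOn ℝ 1 v U := by
    rw [← zero_add (1 : WithTop ℕ∞), contDiffOn_succ_iff_fderiv_of_isOpen hU]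
    refine ⟨hd, by simp, ?_⟩
    rw [contDiffOn_congr heq, contDiffOn_zero]
    exact hA.continuousOn.comp (continuousOn_id.prodMk hd.continuousOn) hmaps
  rw [← one_add_one_eq_two, contDiffOn_succ_iff_fderiv_of_isOpen hU]
  refine ⟨hd, by simp, ?_⟩
  rw [contDiffOn_congr heq]
  exact hA.comp (contDiffOn_id.prodMk h1) hmaps

/-- A real quadratic polynomial with three distinct roots vanishes. -/
theorem quadratic_coeff_eq_zero {α β γ q₁ q₂ q₃ : ℝ} (h₁₂ : q₁ ≠ q₂) (h₁₃ : q₁ ≠ q₃)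
    (h₂₃ : q₂ ≠ q₃) (h₁ : α * q₁ ^ 2 + β * q₁ + γ = 0) (h₂ : α * q₂ ^ 2 + β * q₂ + γ = 0)
    (h₃ : α * q₃ ^ 2 + β * q₃ + γ = 0) : α = 0 ∧ β = 0 ∧ γ = 0 := by
  have e₁ : α * (q₁ + q₂) + β = 0 :=
    mul_left_cancel₀ (sub_ne_zero.2 h₁₂) (by linear_combination h₁ - h₂)
  have e₂ : α * (q₁ + q₃) + β = 0 :=
    mul_left_cancel₀ (sub_ne_zero.2 h₁₃) (by linear_combination h₁ - h₃)
  have hα : α = 0 := mul_left_cancel₀ (sub_ne_zero.2 h₂₃) (by linear_combination e₁ - e₂)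
  have hβ : β = 0 := by simpa [hα] using e₁
  exact ⟨hα, hβ, by simpa [hα, hβ] using h₁⟩

namespace ImagingLens

open scoped RealInnerProductSpace

variable {κ₁ κ₂ C r z : ℝ} {S : Plane → Plane} {x : Plane} {J : Plane →L[ℝ] Plane}

/-- An alternating bilinear form on the plane is a multiple of the determinant. The same reason
gives `inner_mul_inner_sub_eq`. -/
theorem inner_sub_inner_eq (J : Plane →L[ℝ] Plane) (h k : Plane) :
    ⟪J h, k⟫ - ⟪J k, h⟫ = (h 1 * k 0 - h 0 * k 1) *
      (J (EuclideanSpace.single 1 1) 0 - J (EuclideanSpace.single 0 1) 1) := by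
  rw [inner_eq, inner_eq, clm_apply_eq J h, clm_apply_eq J k]
  simp only [PiLp.add_apply, PiLp.smul_apply, smul_eq_mul]
  ring

theorem inner_mul_inner_sub_eq (J : Plane →L[ℝ] Plane) (y h k : Plane) :
    ⟪y, J h⟫ * ⟪y, k⟫ - ⟪y, J k⟫ * ⟪y, h⟫ = (h 1 * k 0 - h 0 * k 1) *
      (y 0 * ⟪y, J (EuclideanSpace.single 1 1)⟫ - y 1 * ⟪y, J (EuclideanSpace.single 0 1)⟫) := by
  rw [clm_apply_eq J h, clm_apply_eq J k]
  simp only [inner_eq, PiLp.add_apply, PiLp.smul_apply, smul_eq_mul]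
  ring

/-- The factor relating `S̄` and `S`. -/
def rescaling (κ₁ κ₂ : ℝ) : ℝ := κ₁ * (κ₁ - κ₂) ^ 2 / (1 - κ₁ * κ₂)

theorem Admissible.rescaling_pos (h : Admissible κ₁ κ₂) : 0 < rescaling κ₁ κ₂ := by
  have := h.diff_pos
  have := h.one_sub_mul_pos
  have := h.one_lt
  unfold rescaling
  positivity

theorem rescaled_eq : rescaled κ₁ κ₂ S x = rescaling κ₁ κ₂ • S x := rfl

theorem hasFDerivAt_rescaled (hS : HasFDerivAt S J x) :
    HasFDerivAt (rescaled κ₁ κ₂ S) (rescaling κ₁ κ₂ • J) x :=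
  hS.const_smul (rescaling κ₁ κ₂)

theorem inner_solvedFieldDeriv_rescaled_sub (h k : Plane) :
    ⟪solvedFieldDeriv κ₁ κ₂ (z⁻¹ • rescaled κ₁ κ₂ S x) (rescaling κ₁ κ₂ • J) z
        (h, ⟪solvedField κ₁ κ₂ S x z, h⟫), k⟫ -
      ⟪solvedFieldDeriv κ₁ κ₂ (z⁻¹ • rescaled κ₁ κ₂ S x) (rescaling κ₁ κ₂ • J) z
        (k, ⟪solvedField κ₁ κ₂ S x z, k⟫), h⟫ =
    z⁻¹ * rescaling κ₁ κ₂ * (h 1 * k 0 - h 0 * k 1) *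
      (profile κ₁ κ₂ (‖z⁻¹ • rescaled κ₁ κ₂ S x‖ ^ 2) *
          (J (EuclideanSpace.single 1 1) 0 - J (EuclideanSpace.single 0 1) 1) +
        2 * deriv (profile κ₁ κ₂) (‖z⁻¹ • rescaled κ₁ κ₂ S x‖ ^ 2) *
          (z⁻¹ * rescaling κ₁ κ₂) ^ 2 *
          (S x 0 * ⟪S x, J (EuclideanSpace.single 1 1)⟫ -
            S x 1 * ⟪S x, J (EuclideanSpace.single 0 1)⟫)) := by
  rw [solvedField, inner_solvedFieldDeriv_sub, inner_sub_inner_eq, inner_mul_inner_sub_eq]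
  simp only [rescaled_eq, smul_apply, PiLp.smul_apply, smul_eq_mul,
    inner_smul_left, inner_smul_right, conj_trivial]
  ring

theorem Admissible.integrableAt_solvedField_iff (hκ : Admissible κ₁ κ₂) (hS : HasFDerivAt S J x)
    (hz : ‖rescaled κ₁ κ₂ S x‖ < |z|) :
    IntegrableAt (solvedField κ₁ κ₂ S) x z ↔
      profile κ₁ κ₂ (‖z⁻¹ • rescaled κ₁ κ₂ S x‖ ^ 2) *
          (J (EuclideanSpace.single 1 1) 0 - J (EuclideanSpace.single 0 1) 1) +
        2 * deriv (profile κ₁ κ₂) (‖z⁻¹ • rescaled κ₁ κ₂ S x‖ ^ 2) *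
          (z⁻¹ * rescaling κ₁ κ₂) ^ 2 *
          (S x 0 * ⟪S x, J (EuclideanSpace.single 1 1)⟫ -
            S x 1 * ⟪S x, J (EuclideanSpace.single 0 1)⟫) = 0 := by
  rw [integrableAt_iff (hκ.hasFDerivAt_solvedField (hasFDerivAt_rescaled hS) hz),
    inner_solvedFieldDeriv_rescaled_sub]
  have := hκ.rescaling_pos.ne'
  have := ne_zero_of_norm_lt_abs hz
  simp [*]

theorem Admissible.integrableAt_of_curlConditions (hκ : Admissible κ₁ κ₂)
    (hS : DifferentiableAt ℝ S x) (hz : ‖rescaled κ₁ κ₂ S x‖ < |z|) (hc : CurlConditions S x) :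
    IntegrableAt (solvedField κ₁ κ₂ S) x z := by
  obtain ⟨h1, h2⟩ := (curlConditions_iff hS.hasFDerivAt).1 hc
  rw [hκ.integrableAt_solvedField_iff hS.hasFDerivAt hz, h1, h2]
  ring

/-- Inserting the formula for `φ'` makes `φ` a common factor; clearing denominators leaves a
relation in `z` and the radical alone. -/
theorem integrability_algebra {P q d E a b c : ℝ} (hP : P ≠ 0) (hq : q ≠ 0) (hd : d ≠ 0)
    (hz : z ≠ 0) (h : P * a + 2 * (E * P / (2 * q * d)) * (z⁻¹ * c) ^ 2 * b = 0) :
    a * z ^ 2 * q * d + E * c ^ 2 * b = 0 := by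
  refine mul_left_cancel₀ hP ?_
  have : P * (a * z ^ 2 * q * d + E * c ^ 2 * b) =
      z ^ 2 * q * d * (P * a + 2 * (E * P / (2 * q * d)) * (z⁻¹ * c) ^ 2 * b) := by
    field_simp
  rw [this, h]
  ring

/-- If the integrability condition holds at `(x, z)` for `z` near `z₀`, then the curl conditions
hold at `x`. -/
theorem Admissible.curlConditions_of_integrableAt (hκ : Admissible κ₁ κ₂)
    (hS : DifferentiableAt ℝ S x) {z₀ : ℝ} (hz₀ : z₀ < 0)
    (hz : ∀ᶠ z in 𝓝 z₀, ‖rescaled κ₁ κ₂ S x‖ < |z| ∧ IntegrableAt (solvedField κ₁ κ₂ S) x z) :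
    CurlConditions S x := by
  rw [curlConditions_iff hS.hasFDerivAt]
  set J := fderiv ℝ S x
  set a := J (EuclideanSpace.single 1 1) 0 - J (EuclideanSpace.single 0 1) 1 with ha
  set b := S x 0 * ⟪S x, J (EuclideanSpace.single 1 1)⟫ -
    S x 1 * ⟪S x, J (EuclideanSpace.single 0 1)⟫ with hb
  set E := (1 - κ₂ ^ 2) * (κ₁ ^ 2 - 1)
  set n := ‖rescaled κ₁ κ₂ S x‖ with hn
  have hn0 : 0 ≤ n := norm_nonneg _
  have hE : 0 < E := hκ.coeff_pos
  have hc := hκ.rescaling_pos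
  have key : ∀ z, n < |z| → IntegrableAt (solvedField κ₁ κ₂ S) x z →
      a * z ^ 2 * radical κ₁ κ₂ ((n / z) ^ 2) *
        (radical κ₁ κ₂ ((n / z) ^ 2) - (1 - κ₁ * κ₂)) + E * rescaling κ₁ κ₂ ^ 2 * b = 0 := by
    intro z hnz hint
    have hz0 := ne_zero_of_norm_lt_abs hnz
    have hr : ‖z⁻¹ • rescaled κ₁ κ₂ S x‖ ^ 2 = (n / z) ^ 2 := by
      rw [norm_smul, ← hn, mul_pow, norm_inv, inv_pow, Real.norm_eq_abs, sq_abs, div_pow]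
      ring
    have hr1 : (n / z) ^ 2 < 1 := hr ▸ sq_norm_lt_one (norm_inv_smul_lt_one hnz)
    rw [hκ.integrableAt_solvedField_iff hS.hasFDerivAt hnz, hr,
      (hκ.hasDerivAt_profile hr1).deriv] at hint
    have hP := (hκ.profile_pos hr1).ne'
    have hq := (hκ.radical_pos hr1).ne'
    have hqD : radical κ₁ κ₂ ((n / z) ^ 2) - (1 - κ₁ * κ₂) ≠ 0 := by
      linarith [hκ.lt_radical hr1]
    rw [← ha, ← hb] at hint
    exact integrability_algebra hP hq hqD hz0 hint
  obtain ⟨δ, hδ, hball⟩ := Metric.eventually_nhds_iff_ball.1 hz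
  -- The samples `z₀ - t δ` move away from zero, so `|z|` increases with `t`.
  have hmem : ∀ t : ℝ, 0 ≤ t → t < 1 → z₀ - t * δ ∈ Metric.ball z₀ δ := by
    intro t ht ht1
    rw [Metric.mem_ball, Real.dist_eq, sub_sub_cancel_left, abs_neg, abs_of_nonneg (by positivity)]
    nlinarith
  have hgood := fun t ht ht1 ↦ hball _ (hmem t ht ht1)
  rcases hn0.eq_or_lt with h0 | hpos
  · have hSx : S x = 0 := by
      have : rescaling κ₁ κ₂ • S x = 0 := norm_eq_zero.1 h0.symm
      simpa [hc.ne'] using this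
    have hb0 : b = 0 := by rw [hb, hSx]; simp
    refine ⟨?_, hb0⟩
    have hz0 := hgood 0 le_rfl one_pos
    rw [zero_mul, sub_zero] at hz0
    have h1 := key _ hz0.1 hz0.2
    rw [hb0, ← h0, mul_zero, add_zero] at h1
    have hq := (hκ.radical_pos zero_lt_one).ne'
    have hqD : radical κ₁ κ₂ 0 - (1 - κ₁ * κ₂) ≠ 0 := by
      linarith [hκ.lt_radical zero_lt_one]
    simpa [hz₀.ne, hq, hqD] using h1
  -- Multiply `key` by `(n / z)²` and use `E (n / z)² = (κ₁ - κ₂)² - q²`, with `q` the radical.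
  · have hroot : ∀ z, n < |z| → IntegrableAt (solvedField κ₁ κ₂ S) x z →
        (a * n ^ 2 - rescaling κ₁ κ₂ ^ 2 * b) * radical κ₁ κ₂ ((n / z) ^ 2) ^ 2 +
          (-(a * n ^ 2 * (1 - κ₁ * κ₂))) * radical κ₁ κ₂ ((n / z) ^ 2) +
          (κ₁ - κ₂) ^ 2 * rescaling κ₁ κ₂ ^ 2 * b = 0 := by
      intro z hnz hint
      have h1 := key z hnz hint
      have hz0 := ne_zero_of_norm_lt_abs hnz
      have hr1 : (n / z) ^ 2 < 1 := by
        rw [div_pow, div_lt_one (by positivity), ← sq_abs z]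
        exact pow_lt_pow_left₀ hnz hn0 two_ne_zero
      have hq2 := hκ.sq_radical hr1
      have hnz2 : (n / z) ^ 2 * z ^ 2 = n ^ 2 := by field_simp
      linear_combination (n / z) ^ 2 * h1 - rescaling κ₁ κ₂ ^ 2 * b * hq2 -
        a * (radical κ₁ κ₂ ((n / z) ^ 2) ^ 2 -
          (1 - κ₁ * κ₂) * radical κ₁ κ₂ ((n / z) ^ 2)) * hnz2
    have hinj : ∀ s t : ℝ, 0 ≤ s → s < t → t < 1 →
        radical κ₁ κ₂ ((n / (z₀ - s * δ)) ^ 2) ≠ radical κ₁ κ₂ ((n / (z₀ - t * δ)) ^ 2) := by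
      intro s t hs hst ht
      have hsδ : 0 ≤ s * δ := by positivity
      have hstδ : s * δ < t * δ := by gcongr
      have habs : |z₀ - s * δ| = -z₀ + s * δ := by rw [abs_of_neg (by linarith)]; ring
      have hns := (hgood s hs (hst.trans ht)).1
      rw [habs] at hns
      have hlt : (n / (z₀ - t * δ)) ^ 2 < (n / (z₀ - s * δ)) ^ 2 := by
        have e : ∀ y : ℝ, (n / (z₀ - y)) ^ 2 = (n / (-z₀ + y)) ^ 2 := fun y ↦ by
          rw [div_pow, div_pow]; congr 1; ring
        rw [e, e]
        exact pow_lt_pow_left₀ (div_lt_div_of_pos_left hpos (by linarith) (by linarith))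
          (div_nonneg hn0 (by linarith)) two_ne_zero
      have hs1 : (n / (z₀ - s * δ)) ^ 2 < 1 := by
        have e : (n / (z₀ - s * δ)) ^ 2 = (n / (-z₀ + s * δ)) ^ 2 := by
          rw [div_pow, div_pow]; congr 1; ring
        rw [e, div_pow, div_lt_one (by have : 0 < -z₀ + s * δ := by linarith
                                       positivity)]
        exact pow_lt_pow_left₀ hns hn0 two_ne_zero
      refine (Real.sqrt_lt_sqrt (hκ.radicand_pos hs1).le ?_).ne
      have := mul_lt_mul_of_pos_left hlt hE
      linarith
    have g₁ := hgood 0 le_rfl one_pos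
    have g₂ := hgood (1 / 3) (by norm_num) (by norm_num)
    have g₃ := hgood (2 / 3) (by norm_num) (by norm_num)
    obtain ⟨-, h2, h3⟩ := quadratic_coeff_eq_zero
      (hinj 0 (1 / 3) le_rfl (by norm_num) (by norm_num))
      (hinj 0 (2 / 3) le_rfl (by norm_num) (by norm_num))
      (hinj (1 / 3) (2 / 3) (by norm_num) (by norm_num) (by norm_num))
      (hroot _ g₁.1 g₁.2) (hroot _ g₂.1 g₂.2) (hroot _ g₃.1 g₃.2)
    have hD := hκ.one_sub_mul_pos.ne'
    have hd := hκ.diff_pos.ne'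
    -- The linear coefficient determines `a`, the constant one `b`.
    refine ⟨?_, ?_⟩
    · simpa [hpos.ne', hD] using h2
    · simpa [hd, hc.ne'] using h3

/-! ### Solving the imaging PDE for the gradient -/

/-- The factor relating the unknowns `v` and `u`. -/
def gradScale (κ₁ κ₂ : ℝ) : ℝ := (κ₁ - κ₂) * √(κ₁ ^ 2 - 1)

theorem Admissible.gradScale_pos (h : Admissible κ₁ κ₂) : 0 < gradScale κ₁ κ₂ :=
  mul_pos h.diff_pos (Real.sqrt_pos.2 h.sq_sub_one_pos)

theorem Admissible.sq_gradScale (h : Admissible κ₁ κ₂) :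
    gradScale κ₁ κ₂ ^ 2 = (κ₁ - κ₂) ^ 2 * (κ₁ ^ 2 - 1) := by
  rw [gradScale, mul_pow, Real.sq_sqrt h.sq_sub_one_pos.le]

/-- The map `y ↦ φ(|y|²) y` inverts the algebraic relation in the imaging PDE. -/
theorem Admissible.smul_eq_smul_iff (h : Admissible κ₁ κ₂) (y g : Plane) :
    gradScale κ₁ κ₂ • g =
        ((κ₁ - κ₂) * √(κ₁ ^ 2 + (κ₁ ^ 2 - 1) * ‖g‖ ^ 2) + κ₁ * (1 - κ₁ * κ₂)) • y ↔
      ‖y‖ < 1 ∧ gradScale κ₁ κ₂ • g = profileMap κ₁ κ₂ y := by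
  have hκ0 : 0 < κ₁ := one_pos.trans h.one_lt
  have hδ := h.diff_pos
  have hD := h.one_sub_mul_pos
  have hm := h.sq_sub_one_pos
  have hc := h.gradScale_pos
  have hc2 := h.sq_gradScale
  have hrad : 0 < κ₁ ^ 2 + (κ₁ ^ 2 - 1) * ‖g‖ ^ 2 := by positivity
  have ht := Real.sqrt_pos.2 hrad
  have ht2 := Real.sq_sqrt hrad.le
  set t := √(κ₁ ^ 2 + (κ₁ ^ 2 - 1) * ‖g‖ ^ 2)
  have hN : 0 < (κ₁ - κ₂) * t + κ₁ * (1 - κ₁ * κ₂) := by positivity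
  set N := (κ₁ - κ₂) * t + κ₁ * (1 - κ₁ * κ₂) with hNdef
  -- Squaring out `t` gives a quadratic equation for `N` once `|g|` is expressed through `|y|`.
  have hN2 : N ^ 2 - 2 * (κ₁ * (1 - κ₁ * κ₂)) * N + (κ₁ * (1 - κ₁ * κ₂)) ^ 2 =
      (κ₁ - κ₂) ^ 2 * κ₁ ^ 2 + gradScale κ₁ κ₂ ^ 2 * ‖g‖ ^ 2 := by
    rw [hc2, hNdef]
    linear_combination (κ₁ - κ₂) ^ 2 * ht2
  constructor
  · intro heq
    have hnorm : gradScale κ₁ κ₂ ^ 2 * ‖g‖ ^ 2 = N ^ 2 * ‖y‖ ^ 2 := by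
      have := congrArg norm heq
      rw [norm_smul, norm_smul, Real.norm_of_nonneg hc.le, Real.norm_of_nonneg hN.le] at this
      rw [← mul_pow, this, mul_pow]
    -- This positivity forces `|y| < 1` and then selects the root with the plus sign.
    have hlow : 0 < N ^ 2 * (1 - ‖y‖ ^ 2) - κ₁ * (1 - κ₁ * κ₂) * N := by
      have : N ^ 2 * (1 - ‖y‖ ^ 2) - κ₁ * (1 - κ₁ * κ₂) * N =
          (κ₁ - κ₂) ^ 2 * κ₁ ^ 2 + κ₁ * (1 - κ₁ * κ₂) * ((κ₁ - κ₂) * t) := by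
        rw [mul_sub, ← hnorm]
        linear_combination hN2 + κ₁ * (1 - κ₁ * κ₂) * hNdef
      rw [this]; positivity
    have hy2 : ‖y‖ ^ 2 < 1 := by
      by_contra! hcon
      have : 0 < κ₁ * (1 - κ₁ * κ₂) * N := by positivity
      nlinarith [mul_nonneg (sq_nonneg N) (sub_nonneg.2 hcon)]
    refine ⟨by nlinarith [norm_nonneg y], ?_⟩
    rw [heq, profileMap]
    congr 1
    have hq : radical κ₁ κ₂ (‖y‖ ^ 2) = (N * (1 - ‖y‖ ^ 2) - κ₁ * (1 - κ₁ * κ₂)) / κ₁ := by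
      rw [radical, Real.sqrt_eq_iff_mul_self_eq (h.radicand_pos hy2).le]
      · rw [hnorm] at hN2
        field_simp
        linear_combination (‖y‖ ^ 2 - 1) * hN2
      · refine div_nonneg ?_ hκ0.le
        have : 0 < N * (N * (1 - ‖y‖ ^ 2) - κ₁ * (1 - κ₁ * κ₂)) := by linarith
        exact (pos_of_mul_pos_right this hN.le).le
    have : 1 - ‖y‖ ^ 2 ≠ 0 := by linarith
    rw [profile_eq hy2, hq]
    field_simp
    ring
  · rintro ⟨hy, heq⟩
    have hy2 := sq_norm_lt_one hy
    rw [heq, profileMap]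
    congr 1
    have hP := h.profile_pos hy2
    have hPq : profile κ₁ κ₂ (‖y‖ ^ 2) * (1 - ‖y‖ ^ 2) =
        κ₁ * (1 - κ₁ * κ₂ + radical κ₁ κ₂ (‖y‖ ^ 2)) := by
      rw [profile_eq hy2, div_mul_cancel₀ _ (by linarith)]
    have hq := h.radical_pos hy2
    have hq2 := h.sq_radical hy2
    set P := profile κ₁ κ₂ (‖y‖ ^ 2)
    set q := radical κ₁ κ₂ (‖y‖ ^ 2)
    have hnorm : gradScale κ₁ κ₂ ^ 2 * ‖g‖ ^ 2 = P ^ 2 * ‖y‖ ^ 2 := by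
      have := congrArg norm heq
      rw [profileMap, norm_smul, norm_smul, Real.norm_of_nonneg hc.le,
        Real.norm_of_nonneg hP.le] at this
      rw [← mul_pow, this, mul_pow]
    have hge : κ₁ * (1 - κ₁ * κ₂) ≤ P := by
      have h1 : 0 < κ₁ * q := by positivity
      nlinarith [mul_nonneg hP.le (sq_nonneg ‖y‖)]
    -- The profile solves the same quadratic; `hge` fixes the sign when the squares are removed.
    have hP2 : (P - κ₁ * (1 - κ₁ * κ₂)) ^ 2 = ((κ₁ - κ₂) * t) ^ 2 := by
      have h1 : ((κ₁ - κ₂) * t) ^ 2 = (κ₁ - κ₂) ^ 2 * κ₁ ^ 2 + P ^ 2 * ‖y‖ ^ 2 := by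
        rw [← hnorm, hc2]
        linear_combination (κ₁ - κ₂) ^ 2 * ht2
      rw [h1]
      refine mul_left_cancel₀ (sub_pos.2 hy2).ne' ?_
      linear_combination (P * (1 - ‖y‖ ^ 2) + κ₁ * (1 - κ₁ * κ₂ + q) -
        2 * (κ₁ * (1 - κ₁ * κ₂))) * hPq + κ₁ ^ 2 * hq2
    have := (pow_left_inj₀ (sub_nonneg.2 hge) (by positivity) two_ne_zero).1 hP2
    linarith

/-- The unknown `v` of the solved equation `Dv = F(x, v)` in terms of the value of `u`. -/
def solvedUnknown (κ₁ κ₂ C t : ℝ) : ℝ := (t + C / (1 - κ₁ * κ₂)) * gradScale κ₁ κ₂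

theorem Admissible.solvedUnknown_neg_iff (h : Admissible κ₁ κ₂) {t : ℝ} :
    solvedUnknown κ₁ κ₂ C t < 0 ↔ t < -C / (1 - κ₁ * κ₂) := by
  rw [solvedUnknown, neg_div]
  refine ⟨fun ht ↦ ?_, fun ht ↦ mul_neg_of_neg_of_pos (by linarith) h.gradScale_pos⟩
  linarith [neg_of_mul_neg_left ht h.gradScale_pos.le]

/-- The imaging PDE is equivalent to `Dv = F(x, v)`. -/
theorem Admissible.imagingPDEAt_iff (h : Admissible κ₁ κ₂) {u : Plane → ℝ}
    (hu : u x < -C / (1 - κ₁ * κ₂)) :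
    ImagingPDEAt κ₁ κ₂ C S u x ↔
      ‖rescaled κ₁ κ₂ S x‖ < |solvedUnknown κ₁ κ₂ C (u x)| ∧
        gradScale κ₁ κ₂ • gradient u x =
          solvedField κ₁ κ₂ S x (solvedUnknown κ₁ κ₂ C (u x)) := by
  have hκ0 : 0 < κ₁ := one_pos.trans h.one_lt
  have hδ := h.diff_pos
  have hD := h.one_sub_mul_pos
  have hm := h.sq_sub_one_pos
  have hc := h.gradScale_pos
  have hc2 := h.sq_gradScale
  have hv := h.solvedUnknown_neg_iff.2 hu
  set v := solvedUnknown κ₁ κ₂ C (u x) with hvdef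
  have hlt : ‖rescaled κ₁ κ₂ S x‖ < |v| ↔ ‖v⁻¹ • rescaled κ₁ κ₂ S x‖ < 1 := by
    rw [norm_smul, norm_inv, Real.norm_eq_abs, inv_mul_lt_one₀ (abs_pos.2 hv.ne)]
  rw [hlt, solvedField, ← h.smul_eq_smul_iff, ImagingPDEAt]
  set g := gradient u x
  have ht : 0 ≤ √(κ₁ ^ 2 + (κ₁ ^ 2 - 1) * ‖g‖ ^ 2) := Real.sqrt_nonneg _
  set t := √(κ₁ ^ 2 + (κ₁ ^ 2 - 1) * ‖g‖ ^ 2)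
  have hN : 0 < (κ₁ - κ₂) * t + κ₁ * (1 - κ₁ * κ₂) := by positivity
  set N := (κ₁ - κ₂) * t + κ₁ * (1 - κ₁ * κ₂) with hNdef
  have hw : (1 - κ₁ * κ₂) * u x + C = (1 - κ₁ * κ₂) * v / gradScale κ₁ κ₂ := by
    rw [hvdef, solvedUnknown]
    field_simp
  have hden : (κ₁ ^ 2 - κ₁ * κ₂) * t + κ₁ ^ 2 * (1 - κ₁ * κ₂) = κ₁ * N := by
    rw [hNdef]; ring
  rw [hw, hden, rescaled_eq]
  -- Nonzero common factor of both sides of the PDE, which is then cancelled.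
  set l := (1 - κ₁ * κ₂) * v / (gradScale κ₁ κ₂ ^ 2 * κ₁ * N) with hl
  have hl0 : l ≠ 0 := by
    have := hv.ne
    positivity
  have e1 : ((1 - κ₁ * κ₂) * v / gradScale κ₁ κ₂ / (κ₁ * N)) • g =
      l • (gradScale κ₁ κ₂ • g) := by
    rw [smul_smul, hl]
    congr 1
    field_simp
  have e2 : (1 / (κ₁ ^ 2 - 1)) • S x = l • (N • (v⁻¹ • (rescaling κ₁ κ₂ • S x))) := by
    rw [smul_smul, smul_smul, smul_smul, hl, hc2, rescaling]
    congr 1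
    have := hv.ne
    field_simp
  rw [e1, e2, smul_right_inj hl0]

end ImagingLens

end

/-! ### Local solvability and the two equivalences assembled -/

noncomputable section

namespace ImagingLens

open scoped RealInnerProductSpace

variable {κ₁ κ₂ C r z : ℝ} {S : Plane → Plane} {x : Plane} {J : Plane →L[ℝ] Plane}

/-- The solved field as a field of linear forms. -/
def solvedForm (κ₁ κ₂ : ℝ) (S : Plane → Plane) (p : Plane × ℝ) : Plane →L[ℝ] ℝ :=
  innerSL ℝ (solvedField κ₁ κ₂ S p.1 p.2)

/-- The part of `V × (-∞, 0)` in which the solved field is smooth. -/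
def solvedDomain (κ₁ κ₂ : ℝ) (S : Plane → Plane) (V : Set Plane) : Set (Plane × ℝ) :=
  {p | p.1 ∈ V ∧ p.2 < 0 ∧ ‖rescaled κ₁ κ₂ S p.1‖ < |p.2|}

variable {V : Set Plane}

theorem isOpen_solvedDomain (hV : IsOpen V) (hS : ContinuousOn S V) :
    IsOpen (solvedDomain κ₁ κ₂ S V) := by
  have h1 : ContinuousOn (fun p : Plane × ℝ ↦ ‖rescaled κ₁ κ₂ S p.1‖ - |p.2|)
      (V ×ˢ Iio (0 : ℝ)) := by
    refine ContinuousOn.sub (ContinuousOn.norm ?_) (by fun_prop)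
    exact (hS.comp continuousOn_fst fun p hp ↦ hp.1).const_smul (rescaling κ₁ κ₂)
  convert! h1.isOpen_inter_preimage (hV.prod isOpen_Iio) (isOpen_Iio (a := (0 : ℝ))) using 1
  ext p
  simp [solvedDomain, and_assoc]

theorem Admissible.contDiffOn_solvedForm (h : Admissible κ₁ κ₂) (hV : IsOpen V)
    (hS : ContDiffOn ℝ 1 S V) :
    ContDiffOn ℝ 1 (solvedForm κ₁ κ₂ S) (solvedDomain κ₁ κ₂ S V) := fun p hp ↦
  ((innerSL ℝ).contDiff.contDiffAt.comp p (h.contDiffAt_solvedField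
    (hS.contDiffAt (hV.mem_nhds hp.1)) hp.2.2)).contDiffWithinAt

/-- Under the curl conditions the system `Dv = F(x, v)` satisfies the hypothesis of the Frobenius
theorem. -/
theorem Admissible.fderiv_solvedForm_symm (h : Admissible κ₁ κ₂) (hV : IsOpen V)
    (hS : ContDiffOn ℝ 1 S V) (hc : ∀ x ∈ V, CurlConditions S x) {p : Plane × ℝ}
    (hp : p ∈ solvedDomain κ₁ κ₂ S V) (a b : Plane) :
    fderiv ℝ (solvedForm κ₁ κ₂ S) p (a, solvedForm κ₁ κ₂ S p a) b =
      fderiv ℝ (solvedForm κ₁ κ₂ S) p (b, solvedForm κ₁ κ₂ S p b) a := by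
  obtain ⟨x, z⟩ := p
  have hSx : HasFDerivAt S (fderiv ℝ S x) x :=
    ((hS.differentiableOn one_ne_zero).differentiableAt (hV.mem_nhds hp.1)).hasFDerivAt
  have h1 := h.hasFDerivAt_solvedField (hasFDerivAt_rescaled hSx) hp.2.2
  have h2 : HasFDerivAt (solvedForm κ₁ κ₂ S) _ (x, z) :=
    HasFDerivAt.comp (x, z) (innerSL ℝ).hasFDerivAt h1
  obtain ⟨c1, c2⟩ := (curlConditions_iff hSx).1 (hc x hp.1)
  have key := inner_solvedFieldDeriv_rescaled_sub (κ₁ := κ₁) (κ₂ := κ₂) (S := S) (x := x) (z := z)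
    (J := fderiv ℝ S x) a b
  rw [c1, c2, mul_zero, mul_zero, add_zero, mul_zero, sub_eq_zero] at key
  rw [h2.fderiv]
  exact key

theorem solvedForm_eq_smul_fderiv {u : Plane → ℝ} (c : ℝ) (hu : c • gradient u x =
    solvedField κ₁ κ₂ S x z) : solvedForm κ₁ κ₂ S (x, z) = c • fderiv ℝ u x := by
  ext k
  rw [solvedForm, ← hu, ← toDual_gradient]
  simp

/-- The PDE itself forces `|S̄ x| < |v|`, so every competing solution has its graph in the domain
where uniqueness applies. -/
theorem Admissible.hasFDerivAt_of_imagingPDEAt (h : Admissible κ₁ κ₂) {u : Plane → ℝ}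
    (hd : DifferentiableAt ℝ u x) (hu : u x < -C / (1 - κ₁ * κ₂))
    (hpde : ImagingPDEAt κ₁ κ₂ C S u x) (hx : x ∈ V) :
    (x, solvedUnknown κ₁ κ₂ C (u x)) ∈ solvedDomain κ₁ κ₂ S V ∧
      HasFDerivAt (fun y ↦ solvedUnknown κ₁ κ₂ C (u y))
        (solvedForm κ₁ κ₂ S (x, solvedUnknown κ₁ κ₂ C (u x))) x := by
  obtain ⟨h1, h2⟩ := (h.imagingPDEAt_iff hu).1 hpde
  refine ⟨⟨hx, h.solvedUnknown_neg_iff.2 hu, h1⟩, ?_⟩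
  rw [solvedForm_eq_smul_fderiv _ h2]
  exact (hd.hasFDerivAt.add_const _).mul_const _

/-- Local existence and uniqueness for the imaging PDE under the curl conditions. -/
theorem Admissible.exists_isImagingSolution (h : Admissible κ₁ κ₂) {Ω : Set Plane}
    (hΩ : IsOpen Ω) (hS : ContDiffOn ℝ 1 S Ω) {x₀ : Plane} (hx₀ : x₀ ∈ Ω)
    (hc : ∀ᶠ x in 𝓝 x₀, CurlConditions S x) {δ₀ : ℝ} (hδ₀ : 0 < δ₀)
    (hneg : solvedUnknown κ₁ κ₂ C δ₀ < 0)
    (hlt : ‖rescaled κ₁ κ₂ S x₀‖ < |solvedUnknown κ₁ κ₂ C δ₀|) :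
    ∃ U : Set Plane, IsOpen U ∧ x₀ ∈ U ∧ U ⊆ Ω ∧ ∃ u : Plane → ℝ,
      IsImagingSolution κ₁ κ₂ C S x₀ δ₀ U u ∧
        ∀ w : Plane → ℝ, IsImagingSolution κ₁ κ₂ C S x₀ δ₀ U w → EqOn w u U := by
  obtain ⟨V, hVc, hVo, hx₀V⟩ := eventually_nhds_iff.1 (hc.and (hΩ.mem_nhds hx₀))
  have hSV : ContDiffOn ℝ 1 S V := hS.mono fun x hx ↦ (hVc x hx).2
  set W := solvedDomain κ₁ κ₂ S V
  have hW : IsOpen W := isOpen_solvedDomain hVo hSV.continuousOn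
  have hA := h.contDiffOn_solvedForm hVo hSV
  have hg := h.gradScale_pos
  obtain ⟨r, hr, v, hv₀, hv⟩ := exists_hasFDerivAt_of_integrable hW hA
    (fun p hp a b ↦ h.fderiv_solvedForm_symm hVo hSV (fun x hx ↦ (hVc x hx).1) hp a b)
    (show (x₀, solvedUnknown κ₁ κ₂ C δ₀) ∈ W from ⟨hx₀V, hneg, hlt⟩)
  set u : Plane → ℝ := fun x ↦ v x * (gradScale κ₁ κ₂)⁻¹ - C / (1 - κ₁ * κ₂) with hu
  have huv : ∀ x, solvedUnknown κ₁ κ₂ C (u x) = v x := fun x ↦ by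
    rw [solvedUnknown, hu]
    field_simp
    ring
  have hu₀ : u x₀ = δ₀ := by
    rw [hu]
    simp only [hv₀, solvedUnknown]
    field_simp
    ring
  have hud : ∀ x ∈ Metric.ball x₀ r,
      HasFDerivAt u ((gradScale κ₁ κ₂)⁻¹ • solvedForm κ₁ κ₂ S (x, v x)) x := fun x hx ↦
    ((hv x hx).2.mul_const _).sub_const _
  have hev : ∀ᶠ x in 𝓝 x₀, 0 < u x :=
    (hud x₀ (Metric.mem_ball_self hr)).continuousAt.eventually_const_lt (by rwa [hu₀])
  obtain ⟨ρ, hρ, hρu⟩ := Metric.eventually_nhds_iff_ball.1 hev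
  -- A ball is convex, as uniqueness along segments requires; the radius `ρ` secures `u > 0`.
  set U := Metric.ball x₀ (min r ρ)
  have hUr : U ⊆ Metric.ball x₀ r := Metric.ball_subset_ball (min_le_left _ _)
  have hUV : ∀ x ∈ U, x ∈ V := fun x hx ↦ (hv x (hUr hx)).1.1
  have hx₀U : x₀ ∈ U := Metric.mem_ball_self (lt_min hr hρ)
  have hult : ∀ x ∈ U, u x < -C / (1 - κ₁ * κ₂) := fun x hx ↦ by
    rw [← h.solvedUnknown_neg_iff, huv]
    exact (hv x (hUr hx)).1.2.1
  refine ⟨U, Metric.isOpen_ball, hx₀U, fun x hx ↦ (hVc x (hUV x hx)).2, u,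
    ⟨?_, fun x hx ↦ ?_, hu₀, fun x hx ↦ hρu x (Metric.ball_subset_ball (min_le_right _ _) hx),
      hult⟩, fun w hw x hx ↦ ?_⟩
  · exact ((contDiffOn_two_of_hasFDerivAt hA Metric.isOpen_ball
      fun x hx ↦ hv x (hUr hx)).mul contDiffOn_const).sub contDiffOn_const
  · rw [h.imagingPDEAt_iff (hult x hx), huv]
    refine ⟨(hv x (hUr hx)).1.2.2, ?_⟩
    have hgrad : HasGradientAt u ((gradScale κ₁ κ₂)⁻¹ • solvedField κ₁ κ₂ S x (v x)) x := by
      rw [hasGradientAt_iff_hasFDerivAt]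
      refine (hud x (hUr hx)).congr_fderiv ?_
      ext k
      simp [solvedForm]
    rw [hgrad.gradient, smul_inv_smul₀ hg.ne']
  · have heq := eqOn_of_hasFDerivAt hW hA (convex_ball x₀ (min r ρ)) hx₀U
      (v₁ := fun y ↦ solvedUnknown κ₁ κ₂ C (w y)) (v₂ := v)
      (fun y hy ↦ h.hasFDerivAt_of_imagingPDEAt
        ((hw.contDiffOn.differentiableOn two_ne_zero).differentiableAt
          (Metric.isOpen_ball.mem_nhds hy)) (hw.lt y hy) (hw.pde y hy) (hUV y hy))
      (fun y hy ↦ hv y (hUr hy)) (by simp only [hw.initial, hv₀]) hx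
    have heq' : solvedUnknown κ₁ κ₂ C (w x) = solvedUnknown κ₁ κ₂ C (u x) := by
      rw [huv]; exact heq
    simpa [solvedUnknown, hg.ne'] using heq'

/-- The integrability condition near `(x₀, z₀)` is equivalent to the curl conditions near `x₀`. -/
theorem Admissible.eventually_integrableAt_iff (h : Admissible κ₁ κ₂) {Ω : Set Plane}
    (hΩ : IsOpen Ω) (hS : ContDiffOn ℝ 1 S Ω) {x₀ : Plane} (hx₀ : x₀ ∈ Ω) {z₀ : ℝ}
    (hz₀ : z₀ < 0) (hlt : ‖rescaled κ₁ κ₂ S x₀‖ < |z₀|) :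
    (∀ᶠ p : Plane × ℝ in 𝓝 (x₀, z₀), IntegrableAt (solvedField κ₁ κ₂ S) p.1 p.2) ↔
      ∀ᶠ x in 𝓝 x₀, CurlConditions S x := by
  have hdom : ∀ᶠ p : Plane × ℝ in 𝓝 (x₀, z₀), p ∈ solvedDomain κ₁ κ₂ S Ω :=
    (isOpen_solvedDomain hΩ hS.continuousOn).mem_nhds ⟨hx₀, hz₀, hlt⟩
  have hdiff : ∀ x ∈ Ω, DifferentiableAt ℝ S x := fun x hx ↦
    (hS.differentiableOn one_ne_zero).differentiableAt (hΩ.mem_nhds hx)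
  constructor
  · intro hint
    have hboth := hdom.and hint
    rw [nhds_prod_eq] at hboth
    -- Currying gives, for each `x` near `x₀`, integrability for all `z` near `z₀`, so `z` can vary
    -- with `x` fixed.
    filter_upwards [hboth.curry, hΩ.mem_nhds hx₀] with x hx hxΩ
    exact h.curlConditions_of_integrableAt (hdiff x hxΩ) hz₀
      (hx.mono fun z hz ↦ ⟨hz.1.2.2, hz.2⟩)
  · intro hcurl
    filter_upwards [hdom, continuousAt_fst.eventually hcurl] with p hp hc
    exact h.integrableAt_of_curlConditions (hdiff _ hp.1) hp.2.2 hc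

/-- Multiplied by `(κ₁ - κ₂) √(κ₁² - 1)`, the upper bound on `δ₀` is exactly `|S̄ x| < -v`. -/
theorem Admissible.norm_rescaled_lt (h : Admissible κ₁ κ₂) {δ₀ : ℝ}
    (hδ₀ : δ₀ < 1 / (1 - κ₁ * κ₂) * (-C - κ₁ * (κ₁ - κ₂) / √(κ₁ ^ 2 - 1) * ‖S x‖)) :
    solvedUnknown κ₁ κ₂ C δ₀ < 0 ∧
      ‖rescaled κ₁ κ₂ S x‖ < |solvedUnknown κ₁ κ₂ C δ₀| := by
  have hκ0 : 0 < κ₁ := one_pos.trans h.one_lt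
  have hδ := h.diff_pos
  have hD := h.one_sub_mul_pos
  have hm := Real.sqrt_pos.2 h.sq_sub_one_pos
  have hlt : ‖rescaled κ₁ κ₂ S x‖ < -solvedUnknown κ₁ κ₂ C δ₀ := by
    rw [rescaled_eq, norm_smul, Real.norm_of_nonneg h.rescaling_pos.le, rescaling, solvedUnknown,
      gradScale]
    rw [one_div_mul_eq_div, lt_div_iff₀ hD] at hδ₀
    have h1 : κ₁ * (κ₁ - κ₂) / √(κ₁ ^ 2 - 1) * ‖S x‖ < -(δ₀ * (1 - κ₁ * κ₂) + C) := by linarith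
    have h2 := mul_lt_mul_of_pos_left h1
      (show 0 < (κ₁ - κ₂) * √(κ₁ ^ 2 - 1) / (1 - κ₁ * κ₂) by positivity)
    convert! h2 using 1 <;> field_simp
  have hneg : solvedUnknown κ₁ κ₂ C δ₀ < 0 := by linarith [norm_nonneg (rescaled κ₁ κ₂ S x)]
  exact ⟨hneg, by rwa [abs_of_neg hneg]⟩

theorem admissible_of_indices {n₁ n₂ n₃ : ℝ} (hn₃ : 0 < n₃) (hn₁₃ : n₃ < n₁) (hn₁₂ : n₁ < n₂) :
    Admissible (n₂ / n₁) (n₃ / n₂) := by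
  have hn₁ : 0 < n₁ := hn₃.trans hn₁₃
  have hn₂ : 0 < n₂ := hn₁.trans hn₁₂
  refine ⟨(one_lt_div hn₁).2 hn₁₂, by positivity, (div_lt_one hn₂).2 (hn₁₃.trans hn₁₂), ?_⟩
  rw [mul_comm, div_mul_div_cancel₀ hn₂.ne']
  exact (div_lt_one hn₁).2 hn₁₃

end ImagingLens

end

theorem theorem6p1
    (n₁ n₂ n₃ κ₁ κ₂ C : ℝ)
    (hn₃ : 0 < n₃) (hn₁₃ : n₃ < n₁) (hn₁₂ : n₁ < n₂)
    (hκ₁ : κ₁ = n₂ / n₁) (hκ₂ : κ₂ = n₃ / n₂) (hC : C < 0)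
    (Ω Ω' : Set ImagingLens.Plane)
    (hΩ : IsOpen Ω) (hΩs : IsSimplyConnected Ω)
    (hΩ' : IsOpen Ω') (hΩ'c : IsConnected Ω')
    (T : ImagingLens.Plane → ImagingLens.Plane)
    (hTbij : Set.BijOn T Ω Ω') (hT : ContDiffOn ℝ 1 T Ω)
    (S : ImagingLens.Plane → ImagingLens.Plane)
    (hS : S = ImagingLens.displacement T)
    (x₀ : ImagingLens.Plane) (hx₀ : x₀ ∈ Ω) :
    -- local existence and uniqueness
    (‖S x₀‖ < -C * √(κ₁ ^ 2 - 1) / (κ₁ * (κ₁ - κ₂)) →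
      (∀ᶠ x in 𝓝 x₀, ImagingLens.CurlConditions S x) →
      ∀ δ₀ : ℝ, 0 < δ₀ →
        δ₀ < 1 / (1 - κ₁ * κ₂) * (-C - κ₁ * (κ₁ - κ₂) / √(κ₁ ^ 2 - 1) * ‖S x₀‖) →
        ∃ U : Set ImagingLens.Plane, IsOpen U ∧ x₀ ∈ U ∧ U ⊆ Ω ∧
          ∃ u : ImagingLens.Plane → ℝ,
            ImagingLens.IsImagingSolution κ₁ κ₂ C S x₀ δ₀ U u ∧
            ∀ w : ImagingLens.Plane → ℝ,
              ImagingLens.IsImagingSolution κ₁ κ₂ C S x₀ δ₀ U w → Set.EqOn w u U) ∧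
    -- the integrability condition is equivalent to the two curl conditions
    (∀ z₀ : ℝ, z₀ < 0 → ‖ImagingLens.rescaled κ₁ κ₂ S x₀‖ < |z₀| →
      ((∀ᶠ p : ImagingLens.Plane × ℝ in 𝓝 (x₀, z₀),
          ImagingLens.IntegrableAt (ImagingLens.solvedField κ₁ κ₂ S) p.1 p.2) ↔
        ∀ᶠ x in 𝓝 x₀, ImagingLens.CurlConditions S x)) := by
  have hκ : ImagingLens.Admissible κ₁ κ₂ := by
    rw [hκ₁, hκ₂]
    exact ImagingLens.admissible_of_indices hn₃ hn₁₃ hn₁₂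
  have hSc : ContDiffOn ℝ 1 S Ω := by
    rw [hS]
    exact hT.sub contDiffOn_id
  refine ⟨fun _ hcurl δ₀ hδ₀ hδ₀' ↦ ?_, fun z₀ hz₀ hlt ↦
    hκ.eventually_integrableAt_iff hΩ hSc hx₀ hz₀ hlt⟩
  obtain ⟨hneg, hlt⟩ := hκ.norm_rescaled_lt hδ₀'
  exact hκ.exists_isImagingSolution hΩ hSc hx₀ hcurl hδ₀ hneg hlt
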